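/- Let $\mathcal H^2_0$ be the space of Dirichlet series $f(s)=\sum_{n\ge 2}a_n n^{-s}$ with $\sum_{n\ge2}|a_n|^2<\infty$; such a series converges absolutely and is holomorphic in $\operatorname{Re}s>1/2$. For $f\in\mathcal H^2_0$ and $\operatorname{Re}s>1/2$ put $$\mathbf Hf(s)=\int_{1/2}^{\infty}f(w)\,(\zeta(w+s)-1)\,dw,\qquad \psi(s)=\sum_{n=2}^\infty\frac{1}{\sqrt n\,\log n}\,n^{-s},$$ where $\zeta$ is the Riemann zeta function. Let $0<\lambda<\pi$ and let $$\theta=\frac1\pi\log\left(\frac{\pi}{\lambda}-\sqrt{\left(\frac{\pi}{\lambda}\right)^2-1}\right).$$ Suppose that $c\in\mathbb C$ and that $f\in\mathcal H^2_0$ satisfies $\mathbf Hf(s)-\lambda f(s)=c\,\psi(s)$ for $\operatorname{Re}s>1/2$. Then there exist a complex number $d$ and polynomially bounded sequences $(c_k)_{k\ge1}$, $(d_k)_{k\ge1}$ of complex numbers (that is, $|c_k|,|d_k|\le Ck^N$ for some constants $C,N$ and all $k\ge1$) such that, with an absolutely convergent series, $$f(s)=cd+\sum_{k=1}^\infty (s-1/2)^{2k-1/2}\left(c_k(s-1/2)^{-i\theta}+d_k(s-1/2)^{i\theta}\right),\qquad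 \tfrac12<s<\tfrac32.$$ In particular, $f'\in L^2(1/2,\infty)$. -/

import Mathlib

open Complex MeasureTheory Set

noncomputable section

namespace MultHilbert

/-- The open half-plane `Re s > 1/2`. -/
def halfPlane : Set ℂ := {s : ℂ | 1 / 2 < s.re}

/-- `f` belongs to the Hardy space `ℋ²₀`: on `Re s > 1/2` it is the sum of a Dirichlet series
`∑_{n ≥ 2} aₙ n⁻ˢ` with square-summable coefficients. Only the values of `f` on the half-plane
matter. -/
def MemH20 (f : ℂ → ℂ) : Prop :=
  ∃ a : ℕ → ℂ, a 0 = 0 ∧ a 1 = 0 ∧ Summable (fun n : ℕ => ‖a n‖ ^ 2) ∧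
    ∀ s ∈ halfPlane, LSeriesHasSum a s (f s)

/-- The integral operator `(H f)(s) = ∫_{1/2}^∞ f(w) (ζ(w + s) - 1) dw`. -/
def opH (f : ℂ → ℂ) (s : ℂ) : ℂ :=
  ∫ w in Ioi (1 / 2 : ℝ), f (w : ℂ) * (riemannZeta ((w : ℂ) + s) - 1)

/-- The analytic symbol `ψ(s) = ∑_{n ≥ 2} n⁻ˢ / (√n log n)`. -/
def symbol (s : ℂ) : ℂ :=
  LSeries (fun n : ℕ => if 2 ≤ n then ((1 / (Real.sqrt n * Real.log n) : ℝ) : ℂ) else 0) s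

/-- `θ(lam) = (1/π) log (π/lam - √((π/lam)² - 1))`. -/
def theta (lam : ℝ) : ℝ :=
  1 / Real.pi * Real.log (Real.pi / lam - Real.sqrt ((Real.pi / lam) ^ 2 - 1))

/-- Polynomially bounded sequences indexed by `k ≥ 1`. -/
def PolyBounded (u : ℕ+ → ℂ) : Prop :=
  ∃ (C : ℝ) (N : ℕ), ∀ k : ℕ+, ‖u k‖ ≤ C * (k : ℝ) ^ N

/-- The `k`-th term `x^{2k-1/2} (cₖ x^{-iθ} + dₖ x^{iθ})`. -/
def repTerm (θ x : ℝ) (ck dk : ℕ+ → ℂ) (k : ℕ+) : ℂ :=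
  ((x ^ (2 * (k : ℝ) - 1 / 2) : ℝ) : ℂ) *
    (ck k * (x : ℂ) ^ (-(I * (θ : ℂ))) + dk k * (x : ℂ) ^ (I * (θ : ℂ)))

end MultHilbert

end

open Filter Topology Asymptotics ComplexConjugate

namespace MultHilbert

/-! ### The kernel `ζ(1 + u) - 1` -/

/-! Put `G y = f (y + 1/2) - c` and `K u = ζ(1 + u) - 1`. The symbol `ψ` is the operator applied to
the constant `1` (`symbol_add_half`), so subtracting `c` absorbs the right-hand side: `lam (G x + c)
= ∫₀^∞ G(y) K(x + y) dy`. This explains `d = 1`.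

`K` decays exponentially to the right and its only pole is a simple one at `0`, with residue `1`. By
Cauchy's theorem (`rayIntegral_eq`) the integral may be taken along the rays of argument `±π/3`. The
rotated integrals continue `G` past the negative axis from either side, and at `-t` the two
continuations differ by the residue at `y = t` (`jump`). Hence `g v = G (exp v)` extends to `|Im v|
< 7π/6` and satisfies `g(v + πi) - g(v - πi) = -(2πi/lam) g(v)`.

The characteristic roots of this difference equation are `-i e^{±πθ}`, which are distinct because
`lam < π`. Thus `g` is a sum of two quasi-periodic parts, each of the form `e^{zv} H(e^{2v})` with
`z = -1/2 ∓ iθ`. The growth bound on `g` makes the singularity of `H` at `0` removable, so `H` is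
entire (`IsRecurrent.exists_entire`).

Square-summability gives `√x G(x) → 0` (`tendsto_sqrt_mul`). Since `x^{iθ}` and `x^{-iθ}` are
independent as `x → 0`, both `H(0)` vanish and the leading exponents rise from `-1/2 ∓ iθ` to `3/2 ∓
iθ` (`exists_decomposition`). Taylor expansion of the two entire functions is the asserted series.
The derivative is bounded near `1/2` and decays exponentially at infinity, hence is
square-integrable. -/

/-- The kernel of the integral operator, centred at its pole. -/
noncomputable def kernel (u : ℂ) : ℂ := riemannZeta (1 + u) - 1

lemma kernel_eq {u : ℂ} (hu : u ≠ 0) :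
    kernel u = u⁻¹ + (riemannZeta₀ (1 + u) - 1) := by
  have h : (1 : ℂ) + u ≠ 1 := by simpa using hu
  rw [kernel, riemannZeta_eq_inv_sub_add h]
  simp [add_sub_assoc]

lemma differentiableAt_kernel {u : ℂ} (hu : u ≠ 0) : DifferentiableAt ℂ kernel u := by
  have h : (1 : ℂ) + u ≠ 1 := by simpa using hu
  unfold kernel
  exact ((differentiableAt_riemannZeta h).comp u (by fun_prop)).sub_const 1

lemma summable_nat_add_two_rpow {σ : ℝ} (hσ : 0 < σ) :
    Summable fun n : ℕ => ((n : ℝ) + 2) ^ (-(1 + σ)) := by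
  refine ((Real.summable_one_div_nat_add_rpow 2 (1 + σ)).2 (by linarith)).congr fun n => ?_
  rw [Real.rpow_neg (by positivity), one_div, abs_of_pos (by positivity)]

/-- `zeta_limit_aux1` reads `∑_{n ≥ 1} n^{-s} - 1/(s-1) = 1 - s T(s)` with `T(s) ≥ 0`; the term `n =
1` cancels the `1`. -/
lemma tsum_nat_add_two_rpow_le_inv {σ : ℝ} (hσ : 0 < σ) :
    ∑' n : ℕ, ((n : ℝ) + 2) ^ (-(1 + σ)) ≤ σ⁻¹ := by
  have h1 := ZetaAsymptotics.zeta_limit_aux1 (s := 1 + σ) (by linarith)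
  have h2 : 0 ≤ ZetaAsymptotics.termTSum (1 + σ) :=
    tsum_nonneg fun n => ZetaAsymptotics.term_nonneg _ _
  have h3 : Summable fun n : ℕ => 1 / ((n : ℝ) + 1) ^ (1 + σ) := by
    refine ((Real.summable_one_div_nat_add_rpow 1 (1 + σ)).2 (by linarith)).congr fun n => ?_
    rw [abs_of_pos (by positivity)]
  rw [h3.tsum_eq_zero_add] at h1
  have h4 : (∑' n : ℕ, 1 / (((n + 1 : ℕ) : ℝ) + 1) ^ (1 + σ)) =
      ∑' n : ℕ, ((n : ℝ) + 2) ^ (-(1 + σ)) := by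
    refine tsum_congr fun n => ?_
    rw [Real.rpow_neg (by positivity), one_div]
    push_cast
    ring_nf
  rw [h4] at h1
  have h5 : 0 ≤ (1 + σ) * ZetaAsymptotics.termTSum (1 + σ) := by positivity
  simp only [Nat.cast_zero, zero_add, Real.one_rpow, add_sub_cancel_left, one_div, inv_one] at h1
  linarith

/-- Half of `σ` is spent on `(n + 2)^{-σ/2} ≤ 2^{-σ/2} ≤ e^{-σ/4}`, as `log 2 > 1/2`; the other half
keeps the sum convergent. -/
lemma tsum_nat_add_two_rpow_le {σ : ℝ} (hσ : 0 < σ) :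
    ∑' n : ℕ, ((n : ℝ) + 2) ^ (-(1 + σ)) ≤ 2 / σ * Real.exp (-(σ / 4)) := by
  have h1 : ∀ n : ℕ, ((n : ℝ) + 2) ^ (-(1 + σ)) ≤
      Real.exp (-(σ / 4)) * ((n : ℝ) + 2) ^ (-(1 + σ / 2)) := fun n => by
    have h2 : (-(1 + σ)) = -(σ / 2) + -(1 + σ / 2) := by ring
    rw [h2, Real.rpow_add (by positivity)]
    refine mul_le_mul_of_nonneg_right ?_ (by positivity)
    rw [Real.rpow_def_of_pos (by positivity)]
    refine Real.exp_le_exp.2 ?_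
    have h3 : Real.log 2 ≤ Real.log ((n : ℝ) + 2) :=
      Real.log_le_log (by norm_num) (by linarith [(Nat.cast_nonneg n : (0 : ℝ) ≤ n)])
    have := Real.log_two_gt_d9
    nlinarith
  calc _ ≤ ∑' n : ℕ, Real.exp (-(σ / 4)) * ((n : ℝ) + 2) ^ (-(1 + σ / 2)) :=
        (summable_nat_add_two_rpow hσ).tsum_le_tsum h1
          ((summable_nat_add_two_rpow (half_pos hσ)).mul_left _)
    _ ≤ Real.exp (-(σ / 4)) * (σ / 2)⁻¹ := by
        rw [tsum_mul_left]
        gcongr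
        exact tsum_nat_add_two_rpow_le_inv (half_pos hσ)
    _ = _ := by rw [inv_div]; ring

lemma norm_nat_add_two_cpow (n : ℕ) (s : ℂ) :
    ‖((n : ℂ) + 2) ^ s‖ = ((n : ℝ) + 2) ^ s.re := by
  have : ((n : ℂ) + 2) = (((n : ℝ) + 2 : ℝ) : ℂ) := by push_cast; rfl
  rw [this, Complex.norm_cpow_eq_rpow_re_of_pos (by positivity)]

lemma hasSum_kernel {u : ℂ} (hu : 0 < u.re) :
    HasSum (fun n : ℕ => ((n : ℂ) + 2) ^ (-(1 + u))) (kernel u) := by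
  have h0 : Summable fun n : ℕ => ((n : ℂ) + 2) ^ (-(1 + u)) := by
    refine Summable.of_norm ((summable_nat_add_two_rpow hu).congr fun n => ?_)
    rw [norm_nat_add_two_cpow]; simp
  have e : ∀ n : ℕ, 1 / (((n + 1 : ℕ) : ℂ) + 1) ^ (1 + u) = ((n : ℂ) + 2) ^ (-(1 + u)) :=
    fun n => by
      rw [Complex.cpow_neg, one_div]; push_cast; ring_nf
  have h1 : Summable fun n : ℕ => 1 / ((n : ℂ) + 1) ^ (1 + u) := by
    refine (summable_nat_add_iff 1).1 (h0.congr fun n => (e n).symm)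
  have h2 := zeta_eq_tsum_one_div_nat_add_one_cpow (s := 1 + u) (by simpa using hu)
  rw [h1.tsum_eq_zero_add, tsum_congr e] at h2
  rw [kernel, h2]
  simpa using h0.hasSum

lemma norm_kernel_le {u : ℂ} (hu : 0 < u.re) :
    ‖kernel u‖ ≤ 2 / u.re * Real.exp (-(u.re / 4)) := by
  rw [← (hasSum_kernel hu).tsum_eq]
  refine (tsum_of_norm_bounded (summable_nat_add_two_rpow hu).hasSum fun n => ?_).trans
    (tsum_nat_add_two_rpow_le hu)
  rw [norm_nat_add_two_cpow]; simp

/-- The pole is simple, so `u K(u)` extends continuously to `0` and is bounded on discs. -/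
lemma exists_norm_kernel_le_div (R : ℝ) :
    ∃ B, 0 < B ∧ ∀ u : ℂ, u ≠ 0 → ‖u‖ ≤ R → ‖kernel u‖ ≤ B / ‖u‖ := by
  have hc : Continuous fun u : ℂ => 1 + u * (riemannZeta₀ (1 + u) - 1) := by
    have := differentiable_riemannZeta₀.continuous
    fun_prop
  obtain ⟨B, hB⟩ := (isCompact_closedBall (0 : ℂ) R).exists_bound_of_continuousOn hc.continuousOn
  refine ⟨max B 1, by positivity, fun u hu hR => ?_⟩
  have h := hB u (by simpa using hR)
  rw [le_div_iff₀ (norm_pos_iff.2 hu), ← norm_mul, kernel_eq hu]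
  refine le_trans (le_of_eq ?_) (h.trans (le_max_left _ _))
  congr 1
  field_simp

/-! ### The kernel along a ray -/

/-- Points which stay away from the ray `-ω · [0, ∞)`. -/
def awayFromRay (ω : ℂ) : Set ℂ := {x | x ≠ 0 ∧ -(9 / 10) * ‖x‖ < (x * conj ω).re}

lemma isOpen_awayFromRay (ω : ℂ) : IsOpen (awayFromRay ω) := by
  have h : IsOpen {x : ℂ | -(9 / 10) * ‖x‖ < (x * conj ω).re} :=
    isOpen_lt (by fun_prop) (Complex.continuous_re.comp (by fun_prop))
  exact isOpen_ne.inter h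

/-- Completing the square, `|x + ωt|² ≥ (t - 9/10 |x|)² + 19/100 |x|²`, and `19/100 ≥ (2/5)²`. -/
lemma norm_add_ray_ge {ω : ℂ} (hω : ‖ω‖ = 1) {x : ℂ} (hx : x ∈ awayFromRay ω) {t : ℝ}
    (ht : 0 ≤ t) : 2 / 5 * ‖x‖ ≤ ‖x + ω * t‖ := by
  have h1 : ‖x + ω * t‖ ^ 2 = ‖x‖ ^ 2 + 2 * t * (x * conj ω).re + t ^ 2 := by
    have h2 : ‖ω‖ ^ 2 = 1 := by rw [hω]; norm_num
    rw [← Complex.normSq_eq_norm_sq] at *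
    rw [← Complex.normSq_eq_norm_sq] at *
    rw [Complex.normSq_apply] at *
    rw [Complex.normSq_apply]
    simp only [add_re, mul_re, ofReal_re, ofReal_im, add_im, mul_im, conj_re, conj_im]
    linear_combination t ^ 2 * h2
  have h3 := hx.2
  have h4 : 0 ≤ ‖x‖ := norm_nonneg x
  refine le_of_sq_le_sq ?_ (norm_nonneg _)
  rw [h1]
  nlinarith [sq_nonneg (t - 9 / 10 * ‖x‖), mul_nonneg ht (sub_nonneg.2 h3.le)]

lemma add_ray_ne_zero {ω : ℂ} (hω : ‖ω‖ = 1) {x : ℂ} (hx : x ∈ awayFromRay ω) {t : ℝ}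
    (ht : 0 ≤ t) : x + ω * t ≠ 0 := by
  have h := norm_add_ray_ge hω hx ht
  have := norm_pos_iff.2 hx.1
  exact norm_pos_iff.1 (by linarith)

/-- Uniform exponential decay of the kernel along a ray in the right half-plane. -/
lemma exists_norm_kernel_ray_le {ω : ℂ} (hω : ‖ω‖ = 1) (hre : ω.re = 1 / 2) {R : ℝ} (hR : 0 < R) :
    ∃ B, 0 < B ∧ ∀ x ∈ awayFromRay ω, ‖x‖ ≤ R → ∀ t : ℝ, 0 ≤ t →
      ‖kernel (x + ω * t)‖ ≤ B * Real.exp (-(t / 8)) / ‖x‖ := by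
  -- For `t ≥ T` the real part of `x + ωt` is at least `-R + T/2 = 1`, where the exponential bound
  -- applies; for `t ≤ T` the pole bound suffices.
  set T : ℝ := 2 * (R + 1) with hT
  obtain ⟨B, hB0, hB⟩ := exists_norm_kernel_le_div (R + T)
  refine ⟨max (B / (2 / 5) * Real.exp (T / 8)) (2 * R * Real.exp (R / 4)), by positivity,
    fun x hx hxR t ht => ?_⟩
  have hx0 := norm_pos_iff.2 hx.1
  have hge := norm_add_ray_ge hω hx ht
  have hωt : ‖ω * (t : ℂ)‖ = t := by rw [norm_mul, hω, Complex.norm_of_nonneg ht, one_mul]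
  rcases le_total t T with h | h
  · have h1 := hB _ (add_ray_ne_zero hω hx ht) ((norm_add_le _ _).trans (by rw [hωt]; linarith))
    calc _ ≤ B / ‖x + ω * t‖ := h1
      _ ≤ B / (2 / 5 * ‖x‖) := by gcongr
      _ = (B / (2 / 5)) * 1 / ‖x‖ := by field_simp
      _ ≤ (B / (2 / 5)) * (Real.exp (T / 8) * Real.exp (-(t / 8))) / ‖x‖ := by
          gcongr
          rw [← Real.exp_add]
          exact Real.one_le_exp (by linarith)
      _ = (B / (2 / 5) * Real.exp (T / 8)) * Real.exp (-(t / 8)) / ‖x‖ := by ring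
      _ ≤ _ := by gcongr; exact le_max_left _ _
  · have hr : (x + ω * t).re = x.re + t / 2 := by simp [hre]; ring
    have hxr := (abs_le.1 ((Complex.abs_re_le_norm x).trans hxR)).1
    have h1 : 1 ≤ (x + ω * t).re := by rw [hr]; linarith
    calc _ ≤ 2 / (x + ω * t).re * Real.exp (-((x + ω * t).re / 4)) := norm_kernel_le (by linarith)
      _ ≤ 2 / 1 * Real.exp (-((x + ω * t).re / 4)) := by gcongr
      _ ≤ 2 / 1 * (Real.exp (R / 4) * Real.exp (-(t / 8))) := by
          gcongr
          rw [← Real.exp_add, hr]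
          exact Real.exp_le_exp.2 (by linarith)
      _ = (2 * Real.exp (R / 4)) * Real.exp (-(t / 8)) * 1 := by ring
      _ ≤ (2 * Real.exp (R / 4)) * Real.exp (-(t / 8)) * (R / ‖x‖) := by
          gcongr
          rwa [one_le_div hx0]
      _ = (2 * R * Real.exp (R / 4)) * Real.exp (-(t / 8)) / ‖x‖ := by ring
      _ ≤ _ := by gcongr; exact le_max_right _ _

/-! ### Rotating the ray of integration -/

/-- The closed sector `|arg y| ≤ π / 3` without its vertex. -/
def sector : Set ℂ := {y | y ≠ 0 ∧ ‖y‖ ≤ 2 * y.re}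

lemma re_pos_of_mem_sector {y : ℂ} (hy : y ∈ sector) : 0 < y.re := by
  have := norm_pos_iff.2 hy.1
  linarith [hy.2]

lemma ray_mem_sector {α : ℝ} (hα : |α| ≤ Real.pi / 3) {t : ℝ} (ht : 0 < t) :
    exp (α * I) * t ∈ sector := by
  refine ⟨mul_ne_zero (exp_ne_zero _) (by exact_mod_cast ht.ne'), ?_⟩
  rw [norm_mul, norm_exp_ofReal_mul_I, one_mul, Complex.norm_of_nonneg ht.le, re_mul_ofReal,
    exp_ofReal_mul_I_re, ← Real.cos_abs]
  have : Real.cos (Real.pi / 3) ≤ Real.cos |α| :=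
    Real.cos_le_cos_of_nonneg_of_le_pi (abs_nonneg _) (by linarith [Real.pi_pos]) hα
  rw [Real.cos_pi_div_three] at this
  nlinarith

lemma norm_ray (α : ℝ) {t : ℝ} (ht : 0 ≤ t) : ‖exp (α * I) * t‖ = t := by
  rw [norm_mul, norm_exp_ofReal_mul_I, one_mul, Complex.norm_of_nonneg ht]

/-- Growth conditions in the sector which make integrals along rays converge. -/
structure RayDecay (Φ : ℂ → ℂ) : Prop where
  zero : Φ =O[𝓝[sector] 0] fun y => ‖y‖ ^ (-(1 / 2) : ℝ)
  infty : Φ =O[Bornology.cobounded ℂ ⊓ 𝓟 sector] fun y => ‖y‖ ^ (-(3 / 2) : ℝ)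

lemma tendsto_ray_zero {α : ℝ} (hα : |α| ≤ Real.pi / 3) :
    Tendsto (fun t : ℝ => exp (α * I) * t) (𝓝[>] 0) (𝓝[sector] 0) := by
  refine tendsto_nhdsWithin_iff.2 ⟨?_, ?_⟩
  · have : Continuous fun t : ℝ => exp (α * I) * t := by fun_prop
    simpa using (this.tendsto 0).mono_left nhdsWithin_le_nhds
  · filter_upwards [self_mem_nhdsWithin] with t ht using ray_mem_sector hα ht

lemma tendsto_ray_atTop {α : ℝ} (hα : |α| ≤ Real.pi / 3) :
    Tendsto (fun t : ℝ => exp (α * I) * t) atTop (Bornology.cobounded ℂ ⊓ 𝓟 sector) := by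
  refine tendsto_inf.2 ⟨?_, tendsto_principal.2 ?_⟩
  · rw [← tendsto_norm_atTop_iff_cobounded]
    refine tendsto_id.congr' ?_
    filter_upwards [eventually_ge_atTop 0] with t ht using (norm_ray α ht).symm
  · filter_upwards [eventually_gt_atTop 0] with t ht using ray_mem_sector hα ht

lemma RayDecay.integrableOn {Φ : ℂ → ℂ} (h : RayDecay Φ) {α : ℝ} (hα : |α| ≤ Real.pi / 3)
    (hc : ContinuousOn (fun t : ℝ => Φ (exp (α * I) * t)) (Ioi 0)) :
    IntegrableOn (fun t : ℝ => Φ (exp (α * I) * t)) (Ioi 0) := by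
  -- Integrability is Mellin convergence at `1`, which lies strictly between the exponents `1/2` and
  -- `3/2`.
  have h1 : MellinConvergent (fun t : ℝ => Φ (exp (α * I) * t)) 1 := by
    refine mellinConvergent_of_isBigO_rpow (a := 3 / 2) (b := 1 / 2)
      (hc.locallyIntegrableOn measurableSet_Ioi) ?_ (by norm_num) ?_ (by norm_num)
    · refine (h.infty.comp_tendsto (tendsto_ray_atTop hα)).trans_eventuallyEq ?_
      filter_upwards [eventually_ge_atTop 0] with t ht
      simp only [Function.comp_apply, norm_ray α ht]
    · refine (h.zero.comp_tendsto (tendsto_ray_zero hα)).trans_eventuallyEq ?_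
      filter_upwards [self_mem_nhdsWithin] with t ht
      simp only [Function.comp_apply, norm_ray α (mem_Ioi.1 ht).le]
  simpa [MellinConvergent] using h1

lemma RayDecay.tendsto_zero {Φ : ℂ → ℂ} (h : RayDecay Φ) :
    Tendsto (fun y => y * Φ y) (𝓝[sector] 0) (𝓝 0) := by
  have h1 : (fun y => y * Φ y) =O[𝓝[sector] 0] fun y => ‖y‖ ^ (1 / 2 : ℝ) := by
    refine ((isBigO_refl (fun y : ℂ => y) _).norm_right.mul h.zero).trans_eventuallyEq ?_
    filter_upwards [self_mem_nhdsWithin] with y hy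
    have := norm_pos_iff.2 hy.1
    nth_rw 1 [← Real.rpow_one ‖y‖]
    rw [← Real.rpow_add this]; norm_num
  refine h1.trans_tendsto ?_
  have : Continuous fun y : ℂ => ‖y‖ ^ (1 / 2 : ℝ) :=
    continuous_norm.rpow_const fun _ => Or.inr (by norm_num)
  simpa using (this.tendsto 0).mono_left nhdsWithin_le_nhds

lemma RayDecay.tendsto_infty {Φ : ℂ → ℂ} (h : RayDecay Φ) :
    Tendsto (fun y => y * Φ y) (Bornology.cobounded ℂ ⊓ 𝓟 sector) (𝓝 0) := by
  have h1 : (fun y => y * Φ y) =O[Bornology.cobounded ℂ ⊓ 𝓟 sector]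
      fun y => ‖y‖ ^ (-(1 / 2) : ℝ) := by
    refine ((isBigO_refl (fun y : ℂ => y) _).norm_right.mul h.infty).trans_eventuallyEq ?_
    filter_upwards [mem_inf_of_right (mem_principal_self _)] with y hy
    have := norm_pos_iff.2 hy.1
    nth_rw 1 [← Real.rpow_one ‖y‖]
    rw [← Real.rpow_add this]; norm_num
  refine h1.trans_tendsto (((tendsto_rpow_neg_atTop (by norm_num)).comp
    tendsto_norm_cobounded_atTop).mono_left inf_le_left)

lemma exp_strip_mem_sector {s θ : ℝ} (hθ : |θ| ≤ Real.pi / 3) : exp (s + θ * I) ∈ sector := by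
  rw [exp_add, mul_comm, ← ofReal_exp]
  exact ray_mem_sector hθ (Real.exp_pos s)

lemma norm_exp_strip (s θ : ℝ) : ‖exp (s + θ * I)‖ = Real.exp s := by
  rw [Complex.norm_exp]; simp

lemma eventually_exp_strip_atBot {p : ℂ → Prop} (h : ∀ᶠ y in 𝓝[sector] 0, p y) :
    ∀ᶠ s : ℝ in atBot, ∀ θ : ℝ, |θ| ≤ Real.pi / 3 → p (exp (s + θ * I)) := by
  obtain ⟨ε, hε, hp⟩ := Metric.mem_nhdsWithin_iff.1 h
  filter_upwards [Real.tendsto_exp_atBot.eventually (gt_mem_nhds hε)] with s hs θ hθ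
  exact hp ⟨by simpa [norm_exp_strip] using hs, exp_strip_mem_sector hθ⟩

lemma eventually_exp_strip_atTop {p : ℂ → Prop}
    (h : ∀ᶠ y in Bornology.cobounded ℂ ⊓ 𝓟 sector, p y) :
    ∀ᶠ s : ℝ in atTop, ∀ θ : ℝ, |θ| ≤ Real.pi / 3 → p (exp (s + θ * I)) := by
  rw [eventually_inf_principal, ← comap_norm_atTop] at h
  obtain ⟨T, hT⟩ := ((atTop_basis.comap _).eventually_iff.1 h)
  filter_upwards [Real.tendsto_exp_atTop.eventually_ge_atTop T] with s hs θ hθ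
  exact hT.2 (by simpa [norm_exp_strip] using hs) (exp_strip_mem_sector hθ)

/-- In the coordinate `y = exp v` arcs of the sector become vertical segments of fixed length; this
makes their contribution vanish in the limit. -/
lemma tendsto_vertical_integral {Φ : ℂ → ℂ} {l : Filter ℝ}
    (h : ∀ ε > 0, ∀ᶠ s : ℝ in l, ∀ θ : ℝ, |θ| ≤ Real.pi / 3 →
      ‖exp (s + θ * I) * Φ (exp (s + θ * I))‖ < ε) {α β : ℝ} (hα : |α| ≤ Real.pi / 3)
    (hβ : |β| ≤ Real.pi / 3) :
    Tendsto (fun s : ℝ => ∫ θ in α..β, exp (s + θ * I) * Φ (exp (s + θ * I))) l (𝓝 0) := by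
  rw [Metric.tendsto_nhds]
  intro ε hε
  have hδ : 0 < ε / (|β - α| + 1) := by positivity
  filter_upwards [h _ hδ] with s hs
  rw [dist_zero_right]
  have h1 : ‖∫ θ in α..β, exp (s + θ * I) * Φ (exp (s + θ * I))‖ ≤
      ε / (|β - α| + 1) * |β - α| := by
    refine intervalIntegral.norm_integral_le_of_norm_le_const fun θ hθ => (hs θ ?_).le
    have h2 := uIoc_subset_uIcc hθ
    rw [abs_le] at hα hβ ⊢
    rcases le_total α β with hab | hab
    · rw [uIcc_of_le hab] at h2; constructor <;> linarith [h2.1, h2.2]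
    · rw [uIcc_of_ge hab] at h2; constructor <;> linarith [h2.1, h2.2]
  refine h1.trans_lt ?_
  rw [div_mul_eq_mul_div, div_lt_iff₀ (by positivity)]
  nlinarith

/-- The substitution `t = e^s` turns the ray into the line `Im v = α`, so that Cauchy's theorem for
rectangles applies. -/
lemma integral_ray_eq_integral_exp (Φ : ℂ → ℂ) (α : ℝ) :
    ∫ t in Ioi (0 : ℝ), exp (α * I) * Φ (exp (α * I) * t) =
      ∫ s : ℝ, exp (s + α * I) * Φ (exp (s + α * I)) := by
  have h := integral_image_eq_integral_abs_deriv_smul (s := univ) MeasurableSet.univ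
    (fun x _ => (Real.hasDerivAt_exp x).hasDerivWithinAt) Real.exp_injective.injOn
    (fun t : ℝ => exp (α * I) * Φ (exp (α * I) * t))
  rw [image_univ, Real.range_exp] at h
  rw [h, setIntegral_univ]
  refine integral_congr_ae (ae_of_all _ fun s => ?_)
  simp only [abs_of_pos (Real.exp_pos s), real_smul, ofReal_exp, exp_add]
  ring_nf

lemma integrable_exp_of_integrableOn_ray {Φ : ℂ → ℂ} {α : ℝ}
    (h : IntegrableOn (fun t : ℝ => Φ (exp (α * I) * t)) (Ioi 0)) :
    Integrable fun s : ℝ => exp (s + α * I) * Φ (exp (s + α * I)) := by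
  have h1 := (integrableOn_image_iff_integrableOn_abs_deriv_smul (s := univ) MeasurableSet.univ
    (fun x _ => (Real.hasDerivAt_exp x).hasDerivWithinAt) Real.exp_injective.injOn
    (fun t : ℝ => exp (α * I) * Φ (exp (α * I) * t)))
  rw [image_univ, Real.range_exp] at h1
  have h2 := h1.1 (h.const_mul _)
  rw [integrableOn_univ] at h2
  refine h2.congr (ae_of_all _ fun s => ?_)
  simp only [abs_of_pos (Real.exp_pos s), real_smul, ofReal_exp, exp_add]
  ring_nf

lemma continuousOn_ray {Φ : ℂ → ℂ} (hd : DifferentiableOn ℂ Φ {y | 0 < y.re}) {α : ℝ}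
    (hα : |α| ≤ Real.pi / 3) : ContinuousOn (fun t : ℝ => Φ (exp (α * I) * t)) (Ioi 0) :=
  hd.continuousOn.comp (by fun_prop) fun _ ht => re_pos_of_mem_sector (ray_mem_sector hα ht)

/-- The integral of `Φ` along the ray of argument `α`. -/
noncomputable def rayIntegral (Φ : ℂ → ℂ) (α : ℝ) : ℂ :=
  ∫ t in Ioi (0 : ℝ), exp (α * I) * Φ (exp (α * I) * t)

/-- Cauchy's theorem in a sector. -/
theorem rayIntegral_eq {Φ : ℂ → ℂ} (hd : DifferentiableOn ℂ Φ {y | 0 < y.re}) (h : RayDecay Φ)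
    {α β : ℝ} (hα : |α| ≤ Real.pi / 3) (hβ : |β| ≤ Real.pi / 3) :
    rayIntegral Φ α = rayIntegral Φ β := by
  set Ω : ℂ → ℂ := fun v => exp v * Φ (exp v) with hΩ
  have hpos : ∀ v : ℂ, |v.im| ≤ Real.pi / 3 → 0 < (exp v).re := fun v hv => by
    have := exp_strip_mem_sector (s := v.re) hv
    rw [re_add_im] at this
    exact re_pos_of_mem_sector this
  have hΩd : ∀ v : ℂ, |v.im| ≤ Real.pi / 3 → DifferentiableAt ℂ Ω v := fun v hv => by
    have h1 : DifferentiableAt ℂ Φ (exp v) :=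
      hd.differentiableAt ((isOpen_lt continuous_const continuous_re).mem_nhds (hpos v hv))
    exact differentiable_exp.differentiableAt.mul
      (h1.comp v differentiable_exp.differentiableAt)
  have hrect : ∀ R : ℝ, (∫ s in (-R)..R, Ω (s + α * I)) - (∫ s in (-R)..R, Ω (s + β * I)) +
      I • (∫ θ in α..β, Ω ((R : ℝ) + θ * I)) - I • (∫ θ in α..β, Ω ((-R : ℝ) + θ * I)) = 0 := by
    intro R
    have := Complex.integral_boundary_rect_eq_zero_of_differentiableOn Ω ⟨-R, α⟩ ⟨R, β⟩
      (fun v hv => (hΩd v ?_).differentiableWithinAt)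
    · simpa using this
    · have h2 : v.im ∈ uIcc α β := hv.2
      rw [abs_le] at hα hβ ⊢
      rcases le_total α β with hab | hab
      · rw [uIcc_of_le hab] at h2; constructor <;> linarith [h2.1, h2.2]
      · rw [uIcc_of_ge hab] at h2; constructor <;> linarith [h2.1, h2.2]
  have hint : ∀ {γ : ℝ}, |γ| ≤ Real.pi / 3 →
      Tendsto (fun R : ℝ => ∫ s in (-R)..R, Ω (s + γ * I)) atTop (𝓝 (rayIntegral Φ γ)) := by
    intro γ hγ
    rw [rayIntegral, integral_ray_eq_integral_exp]
    exact intervalIntegral_tendsto_integral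
      (integrable_exp_of_integrableOn_ray (h.integrableOn hγ (continuousOn_ray hd hγ)))
      tendsto_neg_atTop_atBot tendsto_id
  have hsmall : ∀ {l : Filter ℂ}, Tendsto (fun y => y * Φ y) l (𝓝 0) →
      ∀ ε > 0, ∀ᶠ y in l, ‖y * Φ y‖ < ε := fun {l} hl ε hε => by
    simpa using (Metric.tendsto_nhds.1 hl) ε hε
  have hR : Tendsto (fun R : ℝ => ∫ θ in α..β, Ω ((R : ℝ) + θ * I)) atTop (𝓝 0) :=
    tendsto_vertical_integral
      (fun ε hε => eventually_exp_strip_atTop (hsmall h.tendsto_infty ε hε)) hα hβ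
  have hL : Tendsto (fun R : ℝ => ∫ θ in α..β, Ω ((-R : ℝ) + θ * I)) atTop (𝓝 0) :=
    (tendsto_vertical_integral
      (fun ε hε => eventually_exp_strip_atBot (hsmall h.tendsto_zero ε hε)) hα hβ).comp
      tendsto_neg_atTop_atBot
  have hlim := (((hint hα).sub (hint hβ)).add (hR.const_smul I)).sub (hL.const_smul I)
  simp only [hrect, smul_zero, add_zero, sub_zero] at hlim
  exact (sub_eq_zero.1 (tendsto_nhds_unique hlim tendsto_const_nhds))

/-! ### A residue computation -/

/-- A function with a simple pole at `x` whose integrals along rays are elementary. -/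
noncomputable def poleModel (x : ℝ) (y : ℂ) : ℂ := 2 * x / (y ^ 2 - x ^ 2)

lemma RayDecay.poleModel {x : ℝ} (hx : 0 < x) : RayDecay (poleModel x) := by
  have hx' : (x : ℂ) ≠ 0 := by exact_mod_cast hx.ne'
  constructor
  · have h1 : MultHilbert.poleModel x =O[𝓝[sector] 0] fun _ => (1 : ℝ) := by
      have : ContinuousAt (MultHilbert.poleModel x) 0 := by
        unfold MultHilbert.poleModel
        refine ContinuousAt.div (by fun_prop) (by fun_prop) ?_
        simpa using hx'
      exact (this.tendsto.mono_left nhdsWithin_le_nhds).isBigO_one ℝ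
    refine h1.trans (IsBigO.of_bound 1 ?_)
    filter_upwards [self_mem_nhdsWithin,
      mem_nhdsWithin_of_mem_nhds (Metric.ball_mem_nhds (0 : ℂ) one_pos)] with y hy hy1
    have h2 := norm_pos_iff.2 hy.1
    rw [one_mul, norm_one, Real.norm_of_nonneg (by positivity)]
    exact Real.one_le_rpow_of_pos_of_le_one_of_nonpos h2
      (by simpa using (mem_ball_zero_iff.1 hy1).le) (by norm_num)
  · refine IsBigO.of_bound (4 * x) ?_
    have h1 : ∀ᶠ y in Bornology.cobounded ℂ ⊓ 𝓟 sector, max (2 * x) 1 ≤ ‖y‖ :=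
      (tendsto_norm_cobounded_atTop.eventually_ge_atTop _).filter_mono inf_le_left
    filter_upwards [h1] with y hy
    have hy1 : 1 ≤ ‖y‖ := (le_max_right _ _).trans hy
    have hy2 : 2 * x ≤ ‖y‖ := (le_max_left _ _).trans hy
    have h2 : ‖y‖ ^ 2 / 2 ≤ ‖y ^ 2 - (x : ℂ) ^ 2‖ := by
      have := norm_sub_norm_le (y ^ 2) ((x : ℂ) ^ 2)
      rw [norm_pow, norm_pow, Complex.norm_of_nonneg hx.le] at this
      nlinarith
    rw [MultHilbert.poleModel, norm_div, Real.norm_of_nonneg (by positivity)]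
    have h3 : ‖2 * (x : ℂ)‖ = 2 * x := by simp [abs_of_pos hx]
    rw [h3]
    calc 2 * x / ‖y ^ 2 - (x : ℂ) ^ 2‖ ≤ 2 * x / (‖y‖ ^ 2 / 2) := by gcongr
      _ = 4 * x * ‖y‖ ^ (-2 : ℝ) := by
        rw [Real.rpow_neg (by positivity)]; norm_num; field_simp; norm_num
      _ ≤ _ := by
        gcongr
        norm_num

lemma ray_pi_div_three_im {σ : ℝ} (hσ : σ = 1 ∨ σ = -1) (t : ℝ) :
    (exp ((σ * (Real.pi / 3) : ℝ) * I) * t).im = σ * (t * (√3 / 2)) := by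
  rw [im_mul_ofReal, exp_ofReal_mul_I_im]
  rcases hσ with rfl | rfl
  · rw [one_mul, Real.sin_pi_div_three]; ring
  · rw [neg_one_mul, Real.sin_neg, Real.sin_pi_div_three]; ring

lemma abs_sign_mul_pi_div_three {σ : ℝ} (hσ : σ = 1 ∨ σ = -1) :
    |σ * (Real.pi / 3)| ≤ Real.pi / 3 := by
  have := Real.pi_pos
  rcases hσ with rfl | rfl <;> simp [abs_of_pos (div_pos this three_pos)]

lemma mobius_im_pos {σ x : ℝ} (hx : 0 < x) {y : ℂ}
    (hy : 0 < σ * y.im) : 0 < (-(σ * I) * ((y - x) / (y + x))).re := by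
  have h0 : y.im ≠ 0 := by rintro h; simp [h] at hy
  have hne : y + x ≠ 0 := fun h => h0 (by simpa using congrArg Complex.im h)
  have h1 : (-(σ * I) * ((y - x) / (y + x))).re = σ * ((y - x) / (y + x)).im := by simp
  rw [h1, div_im, ← sub_div, ← mul_div_assoc]
  refine div_pos ?_ (normSq_pos.2 hne)
  simp only [sub_im, ofReal_im, add_re, ofReal_re, sub_re, add_im]
  nlinarith [mul_pos hx hy]

lemma poleModel_differentiableAt {x : ℝ} (hx : 0 < x) {y : ℂ} (hy : 0 < y.re) (hyx : y ≠ x) :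
    y ^ 2 - (x : ℂ) ^ 2 ≠ 0 ∧ DifferentiableAt ℂ (poleModel x) y := by
  have h1 : y + x ≠ 0 := fun h => by
    have := congrArg Complex.re h
    simp at this
    linarith
  have h2 : y ^ 2 - (x : ℂ) ^ 2 ≠ 0 := by
    rw [sq_sub_sq]
    exact mul_ne_zero h1 (sub_ne_zero.2 hyx)
  refine ⟨h2, ?_⟩
  unfold poleModel
  fun_prop (disch := exact h2)

lemma ray_ne_ofReal {σ : ℝ} (hσ : σ = 1 ∨ σ = -1) (x : ℝ) {t : ℝ} (ht : 0 < t) :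
    exp ((σ * (Real.pi / 3) : ℝ) * I) * t ≠ x := fun h => by
  have h1 := congrArg Complex.im h
  rw [ray_pi_div_three_im hσ, ofReal_im] at h1
  have : σ ≠ 0 := by rcases hσ with rfl | rfl <;> norm_num
  exact (mul_ne_zero this (by positivity)) h1

lemma integrableOn_ray_poleModel {σ : ℝ} (hσ : σ = 1 ∨ σ = -1) {x : ℝ} (hx : 0 < x) :
    IntegrableOn (fun t : ℝ => poleModel x (exp ((σ * (Real.pi / 3) : ℝ) * I) * t)) (Ioi 0) := by
  refine (RayDecay.poleModel hx).integrableOn (abs_sign_mul_pi_div_three hσ) fun t ht => ?_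
  have h1 := (poleModel_differentiableAt hx (re_pos_of_mem_sector
    (ray_mem_sector (abs_sign_mul_pi_div_three hσ) ht)) (ray_ne_ofReal hσ x ht)).2.continuousAt
  exact (ContinuousAt.comp (f := fun t : ℝ => exp ((σ * (Real.pi / 3) : ℝ) * I) * t) h1
    (by fun_prop)).continuousWithinAt

/-- A primitive is `log ((y - x)/(y + x))`. The factor `-σi` moves the argument of the logarithm
into the right half-plane along the ray, so the principal branch serves; that argument runs from
`σi` to `-σi`. -/
lemma rayIntegral_poleModel {σ : ℝ} (hσ : σ = 1 ∨ σ = -1) {x : ℝ} (hx : 0 < x) :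
    rayIntegral (poleModel x) (σ * (Real.pi / 3) : ℝ) = -(σ * Real.pi * I) := by
  have hx' : (x : ℂ) ≠ 0 := by exact_mod_cast hx.ne'
  have hσ2 : (σ : ℂ) * σ = 1 := by rcases hσ with rfl | rfl <;> norm_num
  have hσ0 : (σ : ℂ) ≠ 0 := by rintro h; simp [h] at hσ2
  set ω := exp ((σ * (Real.pi / 3) : ℝ) * I) with hω
  have hα := abs_sign_mul_pi_div_three hσ
  have him : ∀ t : ℝ, (ω * t).im = σ * (t * (√3 / 2)) := ray_pi_div_three_im hσ
  have hσσ : σ * σ = 1 := by exact_mod_cast hσ2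
  have hne : ∀ t : ℝ, 0 ≤ t → ω * t + x ≠ 0 := fun t ht h => by
    rcases ht.eq_or_lt with rfl | ht
    · simp [hx.ne'] at h
    · refine ray_ne_ofReal hσ (-x) ht ?_
      rw [← hω]; push_cast; linear_combination h
  let q : ℝ → ℂ := fun t => -(σ * I) * ((ω * t - x) / (ω * t + x))
  have hq0 : q 0 = σ * I := by simp [q, neg_div, div_self hx']
  have hslit0 : q 0 ∈ slitPlane := by
    rw [hq0, mem_slitPlane_iff]; right; simpa using fun h : σ = 0 => by simp [h] at hσσ
  have hslit1 : -(σ * I) ∈ slitPlane := by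
    rw [mem_slitPlane_iff]; right; simpa using fun h : σ = 0 => by simp [h] at hσσ
  have hslit : ∀ t : ℝ, 0 < t → q t ∈ slitPlane := fun t ht => by
    rw [mem_slitPlane_iff]; left
    refine mobius_im_pos hx ?_
    rw [him, ← mul_assoc, hσσ]; positivity
  have hlim : Tendsto q atTop (𝓝 (-(σ * I))) := by
    have h1 : Tendsto (fun t : ℝ => ω * t + x) atTop (Bornology.cobounded ℂ) :=
      tendsto_add_const_cobounded _ |>.comp ((tendsto_ray_atTop hα).mono_right inf_le_left)
    have h2 : Tendsto (fun t : ℝ => -(σ * I) * (1 - 2 * x * (ω * t + x)⁻¹)) atTop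
        (𝓝 (-(σ * I) * (1 - 2 * x * 0))) :=
      ((tendsto_inv₀_cobounded.comp h1).const_mul _ |>.const_sub _).const_mul _
    rw [mul_zero, sub_zero, mul_one] at h2
    refine h2.congr' ?_
    filter_upwards [eventually_ge_atTop 0] with t ht
    have := hne t ht
    simp only [q]
    field_simp
    ring
  have hderiv : ∀ t ∈ Ioi (0 : ℝ), HasDerivAt (fun t => log (q t))
      (ω * poleModel x (ω * t)) t := fun t ht => by
    have h0 := hne t (mem_Ioi.1 ht).le
    have hd1 : HasDerivAt (fun t : ℝ => ω * (t : ℂ)) ω t := by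
      simpa using (ofRealCLM.hasDerivAt (x := t)).const_mul ω
    have hd2 := (((hd1.sub_const (x : ℂ)).div (hd1.add_const (x : ℂ)) h0).const_mul
      (-(σ * I))).clog_real (hslit t ht)
    refine hd2.congr_deriv ?_
    have h3 := ray_ne_ofReal hσ x ht
    rw [← hω] at h3
    have h4 : ω * t - x ≠ 0 := sub_ne_zero.2 h3
    have h5 : (ω * t) ^ 2 - (x : ℂ) ^ 2 ≠ 0 := by rw [sq_sub_sq]; exact mul_ne_zero h0 h4
    simp only [poleModel, Pi.div_apply]
    rw [sq_sub_sq]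
    field_simp
    ring
  have key := integral_Ioi_of_hasDerivAt_of_tendsto
    (f := fun t => log (q t)) (m := log (-(σ * I))) ?_ hderiv
    ((integrableOn_ray_poleModel hσ hx).const_mul _)
    (((continuousAt_clog hslit1).tendsto).comp hlim)
  · rw [rayIntegral, ← hω, key, hq0]
    rcases hσ with rfl | rfl
    · simp [log_I, log_neg_I]; ring
    · simp [log_I, log_neg_I]; ring
  · refine ContinuousAt.continuousWithinAt (ContinuousAt.clog ?_ hslit0)
    have := hne 0 le_rfl
    exact ContinuousAt.mul continuousAt_const (ContinuousAt.div (by fun_prop) (by fun_prop) this)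

/-- Residue theorem for a sector with one simple pole on its axis. -/
theorem rayIntegral_sub_eq_residue {Φ : ℂ → ℂ} {x : ℝ} (hx : 0 < x) {r : ℂ}
    (hd : ∀ y : ℂ, 0 < y.re → y ≠ x → DifferentiableAt ℂ Φ y) (h : RayDecay Φ)
    (hr : Tendsto (fun y => (y - x) * Φ y) (𝓝[≠] (x : ℂ)) (𝓝 r)) :
    rayIntegral Φ (1 * (Real.pi / 3) : ℝ) - rayIntegral Φ ((-1) * (Real.pi / 3) : ℝ) =
      -(2 * Real.pi * I * r) := by
  -- Subtracting the model leaves a removable singularity at `x`, so the two ray integrals of the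
  -- repaired `Ψ'` agree and only those of the model contribute.
  set Ψ : ℂ → ℂ := fun y => Φ y - r * poleModel x y with hΨ
  set Ψ' := Function.update Ψ x (limUnder (𝓝[≠] (x : ℂ)) Ψ) with hΨ'
  have hx' : (x : ℂ) ≠ 0 := by exact_mod_cast hx.ne'
  have hopen : IsOpen {y : ℂ | 0 < y.re} := isOpen_lt continuous_const continuous_re
  have hdiff : DifferentiableOn ℂ Ψ' {y | 0 < y.re} := by
    refine differentiableOn_update_limUnder_of_isLittleO (hopen.mem_nhds (by simpa using hx))
      (fun y hy => ?_) ?_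
    · exact ((hd y hy.1 hy.2).sub
        ((poleModel_differentiableAt hx hy.1 hy.2).2.const_mul r)).differentiableWithinAt
    · have h1 : Tendsto (fun y : ℂ => (y - x) * poleModel x y) (𝓝[≠] (x : ℂ)) (𝓝 1) := by
        have h2 : ContinuousAt (fun y : ℂ => 2 * x / (y + x)) x := by
          refine ContinuousAt.div (by fun_prop) (by fun_prop) ?_
          rw [← two_mul]; simpa using hx'
        have h3 : (2 * x / (x + x) : ℂ) = 1 := by field_simp; norm_num
        have h4 := h2.tendsto.mono_left (nhdsWithin_le_nhds (s := {(x : ℂ)}ᶜ))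
        rw [h3] at h4
        refine h4.congr' ?_
        filter_upwards [self_mem_nhdsWithin] with y hy
        have : y - x ≠ 0 := sub_ne_zero.2 hy
        rw [poleModel, sq_sub_sq, mul_comm (y + x), ← mul_div_assoc, mul_div_mul_left _ _ this]
      -- The value `Ψ x` carries no meaning (the model divides by zero there), but a constant is
      -- killed by the factor `y - x`.
      have h5 : Tendsto (fun y : ℂ => (y - x) * (Ψ y - Ψ x)) (𝓝[≠] (x : ℂ)) (𝓝 0) := by
        have h6 : Tendsto (fun y : ℂ => (y - x) * Ψ x) (𝓝[≠] (x : ℂ)) (𝓝 0) := by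
          have : Continuous fun y : ℂ => (y - x) * Ψ x := by fun_prop
          simpa using (this.tendsto (x : ℂ)).mono_left nhdsWithin_le_nhds
        have h7 := (hr.sub (h1.const_mul r)).sub h6
        rw [mul_one, sub_self, sub_zero] at h7
        refine h7.congr fun y => ?_
        simp only [hΨ]; ring
      refine (isLittleO_iff_tendsto' ?_).2 (h5.congr fun y => ?_)
      · filter_upwards [self_mem_nhdsWithin] with y hy h0
        exact absurd (inv_eq_zero.1 h0) (sub_ne_zero.2 hy)
      · rw [div_inv_eq_mul, mul_comm]
  have hdecay : RayDecay Ψ' := by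
    have hp := RayDecay.poleModel hx
    have e0 : Ψ' =ᶠ[𝓝[sector] 0] Ψ := by
      filter_upwards [mem_nhdsWithin_of_mem_nhds (isOpen_ne.mem_nhds hx'.symm)] with y hy
      exact Function.update_of_ne hy _ _
    have e1 : Ψ' =ᶠ[Bornology.cobounded ℂ ⊓ 𝓟 sector] Ψ := by
      filter_upwards [(Bornology.eventually_ne_cobounded (x : ℂ)).filter_mono inf_le_left]
        with y hy
      exact Function.update_of_ne hy _ _
    exact ⟨e0.trans_isBigO (h.zero.sub (hp.zero.const_mul_left r)),
      e1.trans_isBigO (h.infty.sub (hp.infty.const_mul_left r))⟩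
  have hsplit : ∀ σ : ℝ, σ = 1 ∨ σ = -1 → rayIntegral Ψ' (σ * (Real.pi / 3) : ℝ) =
      rayIntegral Φ (σ * (Real.pi / 3) : ℝ) + r * (σ * Real.pi * I) := fun σ hσ => by
    have hα := abs_sign_mul_pi_div_three hσ
    have hc : ContinuousOn (fun t : ℝ => Φ (exp ((σ * (Real.pi / 3) : ℝ) * I) * t)) (Ioi 0) :=
      fun t ht => by
      have h1 := (hd _ (re_pos_of_mem_sector (ray_mem_sector hα ht))
        (ray_ne_ofReal hσ x ht)).continuousAt
      exact (ContinuousAt.comp (f := fun t : ℝ => exp ((σ * (Real.pi / 3) : ℝ) * I) * t) h1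
        (by fun_prop)).continuousWithinAt
    have e : rayIntegral Ψ' (σ * (Real.pi / 3) : ℝ) = rayIntegral Φ (σ * (Real.pi / 3) : ℝ) -
        r * rayIntegral (poleModel x) (σ * (Real.pi / 3) : ℝ) := by
      simp only [rayIntegral]
      rw [← integral_const_mul, ← integral_sub ((h.integrableOn hα hc).const_mul _)
        (((integrableOn_ray_poleModel hσ hx).const_mul _).const_mul _)]
      refine setIntegral_congr_fun measurableSet_Ioi fun t ht => ?_
      simp only [hΨ', Function.update_of_ne (ray_ne_ofReal hσ x ht), hΨ]
      ring
    rw [e, rayIntegral_poleModel hσ hx]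
    ring
  have hfin := rayIntegral_eq hdiff hdecay (abs_sign_mul_pi_div_three (Or.inl rfl))
    (abs_sign_mul_pi_div_three (Or.inr rfl))
  rw [hsplit 1 (Or.inl rfl), hsplit (-1) (Or.inr rfl)] at hfin
  push_cast at hfin ⊢
  linear_combination hfin

/-! ### Analytic continuation of solutions of the integral equation -/

/-- The integral equation `lam (G + c) = ∫ G(y) K(x + y) dy` for a function which is analytic in
the right half-plane. -/
structure IsSolution (lam : ℝ) (c : ℂ) (G : ℂ → ℂ) : Prop where
  pos : 0 < lam
  diff : DifferentiableOn ℂ G {y | 0 < y.re}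
  bound : ∃ M, 0 ≤ M ∧ ∀ y : ℂ, 0 < y.re → ‖G y‖ ≤ M * (1 + y.re ^ (-(1 / 2) : ℝ))
  eqn : ∀ x : ℝ, 0 < x → lam * (G x + c) = ∫ y in Ioi (0 : ℝ), G y * kernel (y + x)

lemma isBigO_kernel_add_infty (x : ℂ) :
    (fun y => kernel (y + x)) =O[Bornology.cobounded ℂ ⊓ 𝓟 sector]
      fun y => ‖y‖ ^ (-(3 / 2) : ℝ) := by
  have h1 : (fun y => kernel (y + x)) =O[Bornology.cobounded ℂ ⊓ 𝓟 sector]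
      fun y => Real.exp (-(1 / 8) * ‖y‖) := by
    refine IsBigO.of_bound (2 * Real.exp (‖x‖ / 4)) ?_
    filter_upwards [mem_inf_of_right (mem_principal_self _),
      (tendsto_norm_cobounded_atTop.eventually_ge_atTop (2 * (‖x‖ + 1))).filter_mono inf_le_left]
      with y hy hyx
    have hx := (abs_le.1 (Complex.abs_re_le_norm x)).1
    have hre : ‖y‖ / 2 - ‖x‖ ≤ (y + x).re := by rw [add_re]; linarith [hy.2]
    have h1 : 1 ≤ (y + x).re := by linarith
    rw [Real.norm_of_nonneg (Real.exp_pos _).le]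
    calc _ ≤ 2 / (y + x).re * Real.exp (-((y + x).re / 4)) := norm_kernel_le (by linarith)
      _ ≤ 2 / 1 * Real.exp (‖x‖ / 4 + -(1 / 8) * ‖y‖) := by
          gcongr
          linarith
      _ = _ := by rw [Real.exp_add]; ring
  exact h1.trans (((isLittleO_exp_neg_mul_rpow_atTop (by norm_num) _).comp_tendsto
    tendsto_norm_cobounded_atTop).isBigO.mono inf_le_left)

lemma tendsto_mul_kernel : Tendsto (fun u => u * kernel u) (𝓝[≠] 0) (𝓝 1) := by
  have hc : Continuous fun u : ℂ => 1 + u * (riemannZeta₀ (1 + u) - 1) := by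
    have := differentiable_riemannZeta₀.continuous
    fun_prop
  have := (hc.tendsto 0).mono_left (nhdsWithin_le_nhds (s := {(0 : ℂ)}ᶜ))
  simp only [zero_mul, add_zero] at this
  refine this.congr' ?_
  filter_upwards [self_mem_nhdsWithin] with u hu
  have hu' : u ≠ 0 := hu
  rw [kernel_eq hu]
  field_simp

/-- The constant `9/10` in `awayFromRay` is chosen for this: `cos (5π/6) = -√3/2 > -9/10`. -/
lemma exp_mem_awayFromRay {v : ℂ} {α : ℝ} (h : |v.im - α| ≤ 5 * Real.pi / 6) :
    exp v ∈ awayFromRay (exp (α * I)) := by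
  refine ⟨exp_ne_zero v, ?_⟩
  have h1 : (exp v * conj (exp (α * I))).re = Real.exp v.re * Real.cos (v.im - α) := by
    rw [← exp_conj, ← exp_add, exp_re]
    simp [sub_eq_add_neg]
  rw [h1, Complex.norm_exp]
  have h2 : Real.cos (5 * Real.pi / 6) ≤ Real.cos |v.im - α| :=
    Real.cos_le_cos_of_nonneg_of_le_pi (abs_nonneg _) (by linarith [Real.pi_pos]) h
  have h3 : Real.cos (5 * Real.pi / 6) = -(√3 / 2) := by
    rw [← Real.cos_pi_div_six, ← Real.cos_pi_sub]; congr 1; ring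
  have h4 : √3 < 1.8 := by
    rw [Real.sqrt_lt' (by norm_num)]; norm_num
  rw [Real.cos_abs, h3] at h2
  have := Real.exp_pos v.re
  nlinarith

lemma mem_awayFromRay_of_re_pos {σ : ℝ} (hσ : σ = 1 ∨ σ = -1) {x : ℂ} (hx : 0 < x.re) :
    x ∈ awayFromRay (exp ((σ * (Real.pi / 3) : ℝ) * I)) := by
  have hx0 : x ≠ 0 := by rintro rfl; simp at hx
  rw [← exp_log hx0]
  have h1 := (abs_lt.1 (abs_arg_lt_pi_div_two_iff.2 (Or.inl hx)))
  refine exp_mem_awayFromRay ?_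
  rw [log_im, abs_le]
  rcases hσ with rfl | rfl <;> constructor <;> linarith [h1.1, h1.2, Real.pi_pos]

/-! ### Continuation of a solution along rotated rays -/

namespace IsSolution

variable {lam : ℝ} {c : ℂ} {G : ℂ → ℂ}

lemma rayDecay (h : IsSolution lam c G) {x : ℂ} (hx : x ≠ 0) :
    RayDecay fun y => G y * kernel (y + x) := by
  obtain ⟨M, hM, hG⟩ := h.bound
  constructor
  · have h1 : G =O[𝓝[sector] 0] fun y => ‖y‖ ^ (-(1 / 2) : ℝ) := by
      refine IsBigO.of_bound (3 * M) ?_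
      filter_upwards [self_mem_nhdsWithin,
        mem_nhdsWithin_of_mem_nhds (Metric.ball_mem_nhds (0 : ℂ) one_pos)] with y hy hy1
      have h2 := norm_pos_iff.2 hy.1
      have h3 : 1 ≤ ‖y‖ ^ (-(1 / 2) : ℝ) := Real.one_le_rpow_of_pos_of_le_one_of_nonpos h2
        (by simpa using (mem_ball_zero_iff.1 hy1).le) (by norm_num)
      have h4 : y.re ^ (-(1 / 2) : ℝ) ≤ 2 * ‖y‖ ^ (-(1 / 2) : ℝ) := by
        -- The sector gives `‖y‖ / 2 ≤ Re y`; the weaker `1/4` has the convenient power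
        -- `(1/4)^{-1/2} = 2`.
        calc y.re ^ (-(1 / 2) : ℝ) ≤ (4⁻¹ * ‖y‖) ^ (-(1 / 2) : ℝ) :=
              Real.rpow_le_rpow_of_nonpos (by positivity) (by linarith [hy.2]) (by norm_num)
          _ = 2 * ‖y‖ ^ (-(1 / 2) : ℝ) := by
              rw [Real.mul_rpow (by norm_num) h2.le]
              congr 1
              rw [show (4⁻¹ : ℝ) = 2 ^ (-2 : ℝ) by
                rw [Real.rpow_neg (by norm_num)]; norm_num, ← Real.rpow_mul (by norm_num)]
              norm_num
      rw [Real.norm_of_nonneg (by positivity)]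
      refine (hG y (re_pos_of_mem_sector hy)).trans ?_
      nlinarith
    have h2 : (fun y => kernel (y + x)) =O[𝓝[sector] 0] fun _ => (1 : ℝ) := by
      have : ContinuousAt (fun y => kernel (y + x)) 0 :=
        ContinuousAt.comp (f := fun y : ℂ => y + x)
          (differentiableAt_kernel (by simpa using hx)).continuousAt (by fun_prop)
      exact (this.tendsto.mono_left nhdsWithin_le_nhds).isBigO_one ℝ
    simpa using h1.mul h2
  · have h1 : G =O[Bornology.cobounded ℂ ⊓ 𝓟 sector] fun _ => (1 : ℝ) := by
      refine IsBigO.of_bound (2 * M) ?_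
      filter_upwards [mem_inf_of_right (mem_principal_self _),
        (tendsto_norm_cobounded_atTop.eventually_ge_atTop 2).filter_mono inf_le_left]
        with y hy hy2
      have h2 : 1 ≤ y.re := by linarith [hy.2]
      have h3 : y.re ^ (-(1 / 2) : ℝ) ≤ 1 := Real.rpow_le_one_of_one_le_of_nonpos h2 (by norm_num)
      refine (hG y (by linarith)).trans ?_
      rw [norm_one]
      nlinarith
    simpa using h1.mul (isBigO_kernel_add_infty x)

/-- The continuation of the solution obtained by integrating along the ray of argument `α`. -/
noncomputable def cont (lam : ℝ) (c : ℂ) (G : ℂ → ℂ) (α : ℝ) (x : ℂ) : ℂ :=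
  (lam : ℂ)⁻¹ * rayIntegral (fun y => G y * kernel (y + x)) α - c

/-- For `x > 0` the pole `y = -x` lies outside the right half-plane, so the ray may be rotated back
to the positive axis, where the integral equation holds. -/
lemma cont_ofReal (h : IsSolution lam c G) {α : ℝ} (hα : |α| ≤ Real.pi / 3) {x : ℝ} (hx : 0 < x) :
    cont lam c G α x = G x := by
  have hd : DifferentiableOn ℂ (fun y => G y * kernel (y + x)) {y | 0 < y.re} := fun y hy => by
    refine (h.diff y hy).mul (DifferentiableAt.differentiableWithinAt ?_)
    refine DifferentiableAt.comp (f := fun y : ℂ => y + x) y (differentiableAt_kernel ?_)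
      (by fun_prop)
    intro h0
    have := congrArg Complex.re h0
    have hy' : 0 < y.re := hy
    simp at this
    linarith
  have h0 : |(0 : ℝ)| ≤ Real.pi / 3 := by rw [abs_zero]; linarith [Real.pi_pos]
  rw [cont, rayIntegral_eq hd (h.rayDecay (by exact_mod_cast hx.ne')) hα h0, rayIntegral]
  simp only [ofReal_zero, zero_mul, exp_zero, one_mul]
  rw [← h.eqn x hx]
  have : (lam : ℂ) ≠ 0 := by exact_mod_cast h.pos.ne'
  field_simp
  ring

/-- At `x = -t` the pole `y = t` of the integrand lies between the two rays; its residue is `G t`.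
-/
lemma jump (h : IsSolution lam c G) {t : ℝ} (ht : 0 < t) :
    cont lam c G (1 * (Real.pi / 3)) (-t) - cont lam c G ((-1) * (Real.pi / 3)) (-t) =
      -(2 * Real.pi * I / lam * G t) := by
  have h1 : Tendsto (fun y : ℂ => (y - t) * (G y * kernel (y + -t))) (𝓝[≠] (t : ℂ))
      (𝓝 (G t)) := by
    have h2 : Tendsto G (𝓝[≠] (t : ℂ)) (𝓝 (G t)) :=
      ((h.diff.differentiableAt ((isOpen_lt continuous_const continuous_re).mem_nhds
        (by simpa using ht))).continuousAt.tendsto).mono_left nhdsWithin_le_nhds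
    have h3 : Tendsto (fun y : ℂ => y - t) (𝓝[≠] (t : ℂ)) (𝓝[≠] 0) := by
      refine tendsto_nhdsWithin_iff.2 ⟨?_, ?_⟩
      · have : Continuous fun y : ℂ => y - t := by fun_prop
        simpa using (this.tendsto (t : ℂ)).mono_left nhdsWithin_le_nhds
      · filter_upwards [self_mem_nhdsWithin] with y hy using sub_ne_zero.2 hy
    have h4 := h2.mul (tendsto_mul_kernel.comp h3)
    rw [mul_one] at h4
    refine h4.congr fun y => ?_
    simp only [Function.comp_apply, sub_eq_add_neg]
    ring
  have h2 := rayIntegral_sub_eq_residue (Φ := fun y => G y * kernel (y + -t)) ht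
    (fun y hy hyt => ?_) (h.rayDecay (by simpa using ht.ne')) h1
  · simp only [cont]
    linear_combination (lam : ℂ)⁻¹ * h2
  · refine (h.diff.differentiableAt ((isOpen_lt continuous_const continuous_re).mem_nhds hy)).mul ?_
    refine DifferentiableAt.comp (f := fun y : ℂ => y + -t) y (differentiableAt_kernel ?_)
      (by fun_prop)
    rw [← sub_eq_add_neg]
    exact sub_ne_zero.2 hyt

/-- Up to constants this is the dominating function both for the size of the continuation and for
differentiation under the integral. -/
lemma integrableOn_norm_mul_exp (h : IsSolution lam c G) {α : ℝ} (hα : |α| ≤ Real.pi / 3) :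
    IntegrableOn (fun t : ℝ => ‖G (exp (α * I) * t)‖ * Real.exp (-(t / 8))) (Ioi 0) := by
  obtain ⟨M, hM, hG⟩ := h.bound
  have h1 := integrableOn_rpow_mul_exp_neg_mul_rpow (p := 1) (s := 0) (b := 1 / 8)
    (by norm_num) one_pos (by norm_num)
  have h2 := integrableOn_rpow_mul_exp_neg_mul_rpow (p := 1) (s := -(1 / 2)) (b := 1 / 8)
    (by norm_num) one_pos (by norm_num)
  refine Integrable.mono' ((h1.const_mul M).add (h2.const_mul (M * 2))) ?_ ?_
  · refine ContinuousOn.aestronglyMeasurable ?_ measurableSet_Ioi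
    exact (continuousOn_ray h.diff hα).norm.mul (by fun_prop)
  · filter_upwards [ae_restrict_mem measurableSet_Ioi] with t ht
    have ht0 : 0 < t := ht
    have hs := ray_mem_sector hα ht0
    have hr : t / 2 ≤ (exp (α * I) * t).re := by
      have := hs.2; rw [norm_ray α ht0.le] at this; linarith
    have h3 := hG _ (re_pos_of_mem_sector hs)
    have h4 : (exp (α * I) * t).re ^ (-(1 / 2) : ℝ) ≤ 2 * t ^ (-(1 / 2) : ℝ) := by
      calc (exp (α * I) * t).re ^ (-(1 / 2) : ℝ) ≤ (4⁻¹ * t) ^ (-(1 / 2) : ℝ) :=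
            Real.rpow_le_rpow_of_nonpos (by positivity) (by linarith) (by norm_num)
        _ = 2 * t ^ (-(1 / 2) : ℝ) := by
            rw [Real.mul_rpow (by norm_num) ht0.le]
            congr 1
            rw [show (4⁻¹ : ℝ) = 2 ^ (-2 : ℝ) by
              rw [Real.rpow_neg (by norm_num)]; norm_num, ← Real.rpow_mul (by norm_num)]
            norm_num
    have he : Real.exp (-(1 / 8) * t ^ (1 : ℝ)) = Real.exp (-(t / 8)) := by
      rw [Real.rpow_one]; congr 1; ring
    rw [Real.norm_of_nonneg (by positivity)]
    simp only [Pi.add_apply, he, Real.rpow_zero]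
    calc _ ≤ (M * (1 + 2 * t ^ (-(1 / 2) : ℝ))) * Real.exp (-(t / 8)) := by
          gcongr
          exact h3.trans (by gcongr)
      _ = _ := by ring

lemma exp_sign_re {σ : ℝ} (hσ : σ = 1 ∨ σ = -1) :
    (exp ((σ * (Real.pi / 3) : ℝ) * I)).re = 1 / 2 := by
  rw [exp_ofReal_mul_I_re, ← Real.cos_pi_div_three]
  rcases hσ with rfl | rfl
  · rw [one_mul]
  · rw [neg_one_mul, Real.cos_neg]

lemma norm_cont_le (h : IsSolution lam c G) {σ : ℝ} (hσ : σ = 1 ∨ σ = -1) :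
    ∃ B, 0 < B ∧ ∀ x ∈ awayFromRay (exp ((σ * (Real.pi / 3) : ℝ) * I)), ‖x‖ ≤ 1 →
      ‖cont lam c G (σ * (Real.pi / 3)) x‖ ≤ B / ‖x‖ := by
  set ω := exp ((σ * (Real.pi / 3) : ℝ) * I) with hω
  have hω1 : ‖ω‖ = 1 := norm_exp_ofReal_mul_I _
  obtain ⟨B, hB0, hB⟩ := exists_norm_kernel_ray_le hω1 (exp_sign_re hσ) one_pos
  set J := ∫ t in Ioi (0 : ℝ), ‖G (ω * t)‖ * Real.exp (-(t / 8)) with hJ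
  have hJ0 : 0 ≤ J := by positivity
  refine ⟨lam⁻¹ * (B * J) + ‖c‖ + 1, by have := h.pos; positivity, fun x hx hx1 => ?_⟩
  have hx0 := norm_pos_iff.2 hx.1
  have hint := h.integrableOn_norm_mul_exp (abs_sign_mul_pi_div_three hσ)
  have h1 : ‖rayIntegral (fun y => G y * kernel (y + x)) (σ * (Real.pi / 3))‖ ≤ B * J / ‖x‖ := by
    have h2 : ‖rayIntegral (fun y => G y * kernel (y + x)) (σ * (Real.pi / 3))‖ ≤
        ∫ t in Ioi (0 : ℝ), B / ‖x‖ * (‖G (ω * t)‖ * Real.exp (-(t / 8))) := by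
      refine norm_integral_le_of_norm_le (hint.const_mul _) ?_
      filter_upwards [ae_restrict_mem measurableSet_Ioi] with t ht
      rw [← hω, norm_mul, hω1, one_mul, norm_mul, add_comm]
      calc _ ≤ ‖G (ω * t)‖ * (B * Real.exp (-(t / 8)) / ‖x‖) := by
            gcongr
            exact hB x hx hx1 t (mem_Ioi.1 ht).le
        _ = _ := by ring
    rw [integral_const_mul] at h2
    exact h2.trans (le_of_eq (by ring))
  calc ‖cont lam c G (σ * (Real.pi / 3)) x‖
      ≤ lam⁻¹ * (B * J / ‖x‖) + ‖c‖ := by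
        refine (norm_sub_le _ _).trans (add_le_add_left ?_ _)
        rw [norm_mul, norm_inv, Complex.norm_of_nonneg h.pos.le]
        have := h.pos
        gcongr
    _ ≤ lam⁻¹ * (B * J / ‖x‖) + (‖c‖ + 1) * (1 / ‖x‖) := by
        gcongr
        have : 1 ≤ 1 / ‖x‖ := by rwa [one_le_div hx0]
        nlinarith [norm_nonneg c]
    _ = _ := by ring

lemma differentiableAt_cont (h : IsSolution lam c G) {σ : ℝ} (hσ : σ = 1 ∨ σ = -1) {x₀ : ℂ}
    (hx₀ : x₀ ∈ awayFromRay (exp ((σ * (Real.pi / 3) : ℝ) * I))) :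
    DifferentiableAt ℂ (cont lam c G (σ * (Real.pi / 3))) x₀ := by
  have hα := abs_sign_mul_pi_div_three hσ
  set ω := exp ((σ * (Real.pi / 3) : ℝ) * I) with hω
  have hω1 : ‖ω‖ = 1 := norm_exp_ofReal_mul_I _
  have hx0 := norm_pos_iff.2 hx₀.1
  obtain ⟨B, hB0, hB⟩ := exists_norm_kernel_ray_le hω1 (exp_sign_re hσ)
    (R := 2 * ‖x₀‖) (by positivity)
  obtain ⟨ε₀, hε₀, hball⟩ := Metric.isOpen_iff.1 (isOpen_awayFromRay ω) x₀ hx₀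
  -- The parameter moves by `ε`, and a Cauchy circle of radius `ε` around it bounds `deriv kernel`;
  -- hence `2 * ε`.
  obtain ⟨ε, hε, hε1, hε2⟩ : ∃ ε > 0, 2 * ε ≤ ε₀ ∧ 2 * ε ≤ ‖x₀‖ / 2 :=
    ⟨min (ε₀ / 2) (‖x₀‖ / 4), by positivity, by linarith [min_le_left (ε₀ / 2) (‖x₀‖ / 4)],
      by linarith [min_le_right (ε₀ / 2) (‖x₀‖ / 4)]⟩
  have hnear : ∀ x ∈ Metric.ball x₀ (2 * ε), x ∈ awayFromRay ω ∧ ∀ t : ℝ, 0 ≤ t →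
      ‖kernel (ω * t + x)‖ ≤ B * Real.exp (-(t / 8)) / (‖x₀‖ / 2) := fun x hx => by
    have hxa := hball (Metric.ball_subset_ball hε1 hx)
    have hd : ‖x - x₀‖ < 2 * ε := by simpa [dist_eq_norm] using hx
    have h1 : ‖x₀‖ / 2 ≤ ‖x‖ := by
      have := norm_sub_norm_le x₀ x; rw [norm_sub_rev] at this; linarith
    have h2 : ‖x‖ ≤ 2 * ‖x₀‖ := by have := norm_sub_norm_le x x₀; linarith
    refine ⟨hxa, fun t ht => ?_⟩
    rw [add_comm]
    refine (hB x hxa h2 t ht).trans ?_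
    gcongr
  have hker : ∀ x ∈ awayFromRay ω, ∀ t : ℝ, 0 ≤ t → ω * t + x ≠ 0 := fun x hx t ht => by
    rw [add_comm]; exact add_ray_ne_zero hω1 hx ht
  have hGc : ContinuousOn (fun t : ℝ => G (ω * t)) (Ioi 0) := continuousOn_ray h.diff hα
  have hmeas : ∀ x ∈ awayFromRay ω, AEStronglyMeasurable
      (fun t : ℝ => ω * (G (ω * t) * kernel (ω * t + x))) (volume.restrict (Ioi 0)) :=
    fun x hx => by
    refine ContinuousOn.aestronglyMeasurable ?_ measurableSet_Ioi
    refine continuousOn_const.mul (hGc.mul fun t ht => ContinuousAt.continuousWithinAt ?_)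
    exact ContinuousAt.comp (f := fun t : ℝ => ω * t + x)
      (differentiableAt_kernel (hker x hx t (mem_Ioi.1 ht).le)).continuousAt (by fun_prop)
  have hint := h.integrableOn_norm_mul_exp hα
  have hx₀b : x₀ ∈ Metric.ball x₀ (2 * ε) := Metric.mem_ball_self (by positivity)
  have key := hasDerivAt_integral_of_dominated_loc_of_deriv_le
    (μ := volume.restrict (Ioi (0 : ℝ)))
    (F := fun (x : ℂ) (t : ℝ) => ω * (G (ω * t) * kernel (ω * t + x)))
    (F' := fun (x : ℂ) (t : ℝ) => ω * (G (ω * t) * deriv kernel (ω * t + x)))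
    (bound := fun t => B / (‖x₀‖ / 2) / ε * (‖G (ω * t)‖ * Real.exp (-(t / 8))))
    (Metric.ball_mem_nhds x₀ hε)
    (eventually_of_mem ((isOpen_awayFromRay ω).mem_nhds hx₀) hmeas) ?_ ?_ ?_
    (hint.const_mul _) ?_
  · exact ((key.2.differentiableAt).const_mul _).sub_const _
  · refine Integrable.mono' (hint.const_mul (B / (‖x₀‖ / 2))) (hmeas x₀ hx₀) ?_
    filter_upwards [ae_restrict_mem measurableSet_Ioi] with t ht
    rw [norm_mul, hω1, one_mul, norm_mul]
    calc _ ≤ ‖G (ω * t)‖ * (B * Real.exp (-(t / 8)) / (‖x₀‖ / 2)) := by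
          gcongr
          exact (hnear x₀ hx₀b).2 t (mem_Ioi.1 ht).le
      _ = _ := by ring
  · refine ContinuousOn.aestronglyMeasurable ?_ measurableSet_Ioi
    refine continuousOn_const.mul (hGc.mul fun t ht => ContinuousAt.continuousWithinAt ?_)
    have hdk : ContinuousAt (deriv kernel) (ω * t + x₀) :=
      ((DifferentiableOn.deriv (s := {0}ᶜ) (fun u hu =>
        (differentiableAt_kernel hu).differentiableWithinAt) isOpen_ne).differentiableAt
        (isOpen_ne.mem_nhds (hker x₀ hx₀ t (mem_Ioi.1 ht).le))).continuousAt
    exact ContinuousAt.comp (f := fun t : ℝ => ω * t + x₀) hdk (by fun_prop)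
  · filter_upwards [ae_restrict_mem measurableSet_Ioi] with t ht x hx
    have ht0 : 0 ≤ t := (mem_Ioi.1 ht).le
    have hd : ‖deriv kernel (ω * t + x)‖ ≤ B * Real.exp (-(t / 8)) / (‖x₀‖ / 2) / ε := by
      have hsub : ∀ z ∈ Metric.closedBall (ω * t + x) ε,
          z - ω * t ∈ Metric.ball x₀ (2 * ε) := fun z hz => by
        have h1 : ‖z - (ω * t + x)‖ ≤ ε := by simpa [dist_eq_norm] using hz
        have h2 : ‖x - x₀‖ < ε := by simpa [dist_eq_norm] using hx
        rw [mem_ball_iff_norm]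
        calc ‖z - ω * t - x₀‖ = ‖(z - (ω * t + x)) + (x - x₀)‖ := by congr 1; ring
          _ ≤ _ := norm_add_le _ _
          _ < 2 * ε := by linarith
      refine Complex.norm_deriv_le_of_forall_mem_sphere_norm_le hε ?_ fun z hz => ?_
      · refine DifferentiableOn.diffContOnCl fun z hz => ?_
        rw [closure_ball _ hε.ne'] at hz
        have := hker _ (hnear _ (hsub z hz)).1 t ht0
        rw [add_sub_cancel] at this
        exact (differentiableAt_kernel this).differentiableWithinAt
      · have := (hnear _ (hsub z (Metric.sphere_subset_closedBall hz))).2 t ht0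
        rwa [add_sub_cancel] at this
    rw [norm_mul, hω1, one_mul, norm_mul]
    calc _ ≤ ‖G (ω * t)‖ * (B * Real.exp (-(t / 8)) / (‖x₀‖ / 2) / ε) := by gcongr
      _ = _ := by ring
  · filter_upwards [ae_restrict_mem measurableSet_Ioi] with t ht x hx
    have h1 := (differentiableAt_kernel (hker x
      (hnear x (Metric.ball_subset_ball (by linarith) hx)).1 t (mem_Ioi.1 ht).le)).hasDerivAt
    exact ((h1.comp_const_add (ω * t) x).const_mul _).const_mul _

lemma cont_eq (h : IsSolution lam c G) {σ : ℝ} (hσ : σ = 1 ∨ σ = -1) {x : ℂ} (hx : 0 < x.re) :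
    cont lam c G (σ * (Real.pi / 3)) x = G x := by
  have hopen : IsOpen {y : ℂ | 0 < y.re} := isOpen_lt continuous_const continuous_re
  have h1 : AnalyticOnNhd ℂ (cont lam c G (σ * (Real.pi / 3))) {y | 0 < y.re} :=
    DifferentiableOn.analyticOnNhd (fun y hy => (h.differentiableAt_cont hσ
      (mem_awayFromRay_of_re_pos hσ hy)).differentiableWithinAt) hopen
  refine h1.eqOn_of_preconnected_of_frequently_eq (h.diff.analyticOnNhd hopen)
    (convex_halfSpace_re_gt 0).isPreconnected (z₀ := 1) (by simp) ?_ hx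
  have h2 : Tendsto (fun t : ℝ => (t : ℂ)) (𝓝[>] 1) (𝓝[≠] 1) := by
    refine tendsto_nhdsWithin_iff.2 ⟨?_, ?_⟩
    · exact_mod_cast (continuous_ofReal.tendsto 1).mono_left nhdsWithin_le_nhds
    · filter_upwards [self_mem_nhdsWithin] with t ht
      simpa using (mem_Ioi.1 ht).ne'
  refine h2.frequently (Eventually.frequently ?_)
  filter_upwards [self_mem_nhdsWithin] with t ht
  exact h.cont_ofReal (abs_sign_mul_pi_div_three hσ) (one_pos.trans ht)

end IsSolution

/-! ### The logarithmic strip and the difference equation -/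

namespace IsSolution

variable {lam : ℝ} {c : ℂ} {G : ℂ → ℂ}

/-- The continuation of `v ↦ G (exp v)` to the strip `|Im v| < 7π/6`. -/
noncomputable def logCont (lam : ℝ) (c : ℂ) (G : ℂ → ℂ) (v : ℂ) : ℂ :=
  if 0 ≤ v.im then cont lam c G (1 * (Real.pi / 3)) (exp v)
  else cont lam c G ((-1) * (Real.pi / 3)) (exp v)

lemma exp_re_pos {v : ℂ} (hv : |v.im| < Real.pi / 2) : 0 < (exp v).re := by
  rw [exp_re]
  exact mul_pos (Real.exp_pos _) (Real.cos_pos_of_mem_Ioo (abs_lt.1 hv))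

/-- Both branches equal `G ∘ exp` on `|Im v| < π/2`, so the seam at `Im v = 0` in the definition is
immaterial. -/
lemma logCont_upper (h : IsSolution lam c G) {v : ℂ} (hv : -(Real.pi / 2) < v.im) :
    logCont lam c G v = cont lam c G (1 * (Real.pi / 3)) (exp v) := by
  unfold logCont
  split_ifs with h0
  · rfl
  · have h1 := exp_re_pos (v := v) (abs_lt.2 ⟨hv, by linarith [Real.pi_pos]⟩)
    rw [h.cont_eq (Or.inl rfl) h1, h.cont_eq (Or.inr rfl) h1]

lemma logCont_lower (h : IsSolution lam c G) {v : ℂ} (hv : v.im < Real.pi / 2) :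
    logCont lam c G v = cont lam c G ((-1) * (Real.pi / 3)) (exp v) := by
  unfold logCont
  split_ifs with h0
  · have h1 := exp_re_pos (v := v) (abs_lt.2 ⟨by linarith [Real.pi_pos], hv⟩)
    rw [h.cont_eq (Or.inl rfl) h1, h.cont_eq (Or.inr rfl) h1]
  · rfl

lemma logCont_eq (h : IsSolution lam c G) {v : ℂ} (hv : |v.im| < Real.pi / 2) :
    logCont lam c G v = G (exp v) := by
  rw [h.logCont_upper (abs_lt.1 hv).1, h.cont_eq (Or.inl rfl) (exp_re_pos hv)]

/-- Here `7π/6 = π/3 + 5π/6`. The excess over `π` leaves room for both shifts `v ± πi` when `|Im v|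
< π/6`. -/
lemma exp_mem_upper {v : ℂ} (h1 : -(Real.pi / 2) ≤ v.im) (h2 : v.im ≤ 7 * Real.pi / 6) :
    exp v ∈ awayFromRay (exp ((1 * (Real.pi / 3) : ℝ) * I)) :=
  exp_mem_awayFromRay (abs_le.2 ⟨by linarith, by linarith⟩)

lemma exp_mem_lower {v : ℂ} (h1 : -(7 * Real.pi / 6) ≤ v.im) (h2 : v.im ≤ Real.pi / 2) :
    exp v ∈ awayFromRay (exp (((-1) * (Real.pi / 3) : ℝ) * I)) :=
  exp_mem_awayFromRay (abs_le.2 ⟨by linarith, by linarith⟩)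

lemma differentiableAt_logCont (h : IsSolution lam c G) {v : ℂ}
    (hv : |v.im| < 7 * Real.pi / 6) : DifferentiableAt ℂ (logCont lam c G) v := by
  rw [abs_lt] at hv
  have hpi := Real.pi_pos
  rcases le_total 0 v.im with h0 | h0
  · have h1 : (fun w => cont lam c G (1 * (Real.pi / 3)) (exp w)) =ᶠ[𝓝 v] logCont lam c G := by
      filter_upwards [(isOpen_lt continuous_const continuous_im).mem_nhds
        (show -(Real.pi / 2) < v.im by linarith)] with w hw using (h.logCont_upper hw).symm
    refine DifferentiableAt.congr_of_eventuallyEq ?_ h1.symm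
    exact (h.differentiableAt_cont (Or.inl rfl) (exp_mem_upper (by linarith) hv.2.le)).comp v
      differentiable_exp.differentiableAt
  · have h1 : (fun w => cont lam c G ((-1) * (Real.pi / 3)) (exp w)) =ᶠ[𝓝 v] logCont lam c G := by
      filter_upwards [(isOpen_lt continuous_im continuous_const).mem_nhds
        (show v.im < Real.pi / 2 by linarith)] with w hw using (h.logCont_lower hw).symm
    refine DifferentiableAt.congr_of_eventuallyEq ?_ h1.symm
    exact (h.differentiableAt_cont (Or.inr rfl) (exp_mem_lower (by linarith) (by linarith))).comp v
      differentiable_exp.differentiableAt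

lemma norm_logCont_le (h : IsSolution lam c G) : ∃ B, 0 < B ∧ ∀ v : ℂ, |v.im| ≤ Real.pi →
    v.re ≤ 0 → ‖logCont lam c G v‖ ≤ B * Real.exp (-v.re) := by
  obtain ⟨B₁, hB₁, h1⟩ := h.norm_cont_le (Or.inl rfl)
  obtain ⟨B₂, hB₂, h2⟩ := h.norm_cont_le (Or.inr rfl)
  have hpi := Real.pi_pos
  refine ⟨max B₁ B₂, by positivity, fun v hv hre => ?_⟩
  have hn : ‖exp v‖ ≤ 1 := by rw [Complex.norm_exp]; exact Real.exp_le_one_iff.2 hre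
  rw [abs_le] at hv
  rw [Real.exp_neg, ← div_eq_mul_inv]
  rcases le_total 0 v.im with h0 | h0
  · rw [h.logCont_upper (by linarith)]
    refine (h1 _ (exp_mem_upper (by linarith) (by linarith)) hn).trans ?_
    rw [Complex.norm_exp]
    gcongr
    exact le_max_left _ _
  · rw [h.logCont_lower (by linarith)]
    refine (h2 _ (exp_mem_lower (by linarith) (by linarith)) hn).trans ?_
    rw [Complex.norm_exp]
    gcongr
    exact le_max_right _ _

/-- For real `v = t` this is `jump` at `exp t`, since `exp (t ± πi) = -exp t`; the identity theorem
carries it to the strip. -/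
lemma logCont_jump (h : IsSolution lam c G) {v : ℂ} (hv : |v.im| < Real.pi / 6) :
    logCont lam c G (v + Real.pi * I) - logCont lam c G (v - Real.pi * I) =
      -(2 * Real.pi * I / lam) * logCont lam c G v := by
  have hpi := Real.pi_pos
  set S : Set ℂ := {v | |v.im| < Real.pi / 6} with hS
  have hopen : IsOpen S := isOpen_lt (by fun_prop) continuous_const
  have hconv : Convex ℝ S := by
    have : S = imLm ⁻¹' Ioo (-(Real.pi / 6)) (Real.pi / 6) := by
      ext v; simp [hS, abs_lt]
    rw [this]
    exact (convex_Ioo _ _).linear_preimage _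
  have hd1 : DifferentiableOn ℂ (fun v => logCont lam c G (v + Real.pi * I) -
      logCont lam c G (v - Real.pi * I)) S := fun v hv => by
    have hv' : |v.im| < Real.pi / 6 := hv
    rw [abs_lt] at hv'
    have e1 : DifferentiableAt ℂ (fun v => logCont lam c G (v + Real.pi * I)) v :=
      DifferentiableAt.comp (f := fun v : ℂ => v + Real.pi * I) v
        (h.differentiableAt_logCont (by simp [abs_lt]; constructor <;> linarith)) (by fun_prop)
    have e2 : DifferentiableAt ℂ (fun v => logCont lam c G (v - Real.pi * I)) v :=
      DifferentiableAt.comp (f := fun v : ℂ => v - Real.pi * I) v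
        (h.differentiableAt_logCont (by simp [abs_lt]; constructor <;> linarith)) (by fun_prop)
    exact (e1.sub e2).differentiableWithinAt
  have hd2 : DifferentiableOn ℂ (fun v => -(2 * Real.pi * I / lam) * logCont lam c G v) S :=
    fun v hv => by
    have hv' : |v.im| < Real.pi / 6 := hv
    exact ((h.differentiableAt_logCont (by linarith)).const_mul _).differentiableWithinAt
  refine (hd1.analyticOnNhd hopen).eqOn_of_preconnected_of_frequently_eq (hd2.analyticOnNhd hopen)
    hconv.isPreconnected (z₀ := 0) (by simp [hS, hpi]) ?_ hv
  have h2 : Tendsto (fun t : ℝ => (t : ℂ)) (𝓝[>] 0) (𝓝[≠] 0) := by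
    refine tendsto_nhdsWithin_iff.2 ⟨?_, ?_⟩
    · exact_mod_cast (continuous_ofReal.tendsto 0).mono_left nhdsWithin_le_nhds
    · filter_upwards [self_mem_nhdsWithin] with t ht
      simpa using (mem_Ioi.1 ht).ne'
  refine h2.frequently (Eventually.frequently (Eventually.of_forall fun t => ?_))
  rw [h.logCont_upper (by simp; linarith), h.logCont_lower (by simp; linarith),
    h.logCont_eq (by simp [hpi]), exp_add, exp_sub, exp_pi_mul_I]
  have := h.jump (Real.exp_pos t)
  push_cast at this ⊢
  rw [mul_neg_one, div_neg, div_one]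
  linear_combination this

end IsSolution

/-! ### Solutions of the difference equation -/

/-- A function analytic in a strip, of controlled growth to the left, which satisfies a second order
difference equation with step `π i`. -/
structure IsRecurrent (g : ℂ → ℂ) (b : ℂ) : Prop where
  diff : ∀ v : ℂ, |v.im| < 7 * Real.pi / 6 → DifferentiableAt ℂ g v
  bound : ∃ B, 0 < B ∧ ∀ v : ℂ, |v.im| ≤ Real.pi → v.re ≤ 0 → ‖g v‖ ≤ B * Real.exp (-v.re)
  jump : ∀ v : ℂ, |v.im| < Real.pi / 6 → g (v + Real.pi * I) - g (v - Real.pi * I) = b * g v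

/-- The branch of `log w / 2` with imaginary part in `(-π, 0]`. -/
noncomputable def halfLog (w : ℂ) : ℂ := (log (-w) - Real.pi * I) / 2

lemma exp_two_halfLog {w : ℂ} (hw : w ≠ 0) : exp (2 * halfLog w) = w := by
  rw [halfLog, mul_div_cancel₀ _ two_ne_zero, exp_sub, exp_log (neg_ne_zero.2 hw), exp_pi_mul_I]
  ring

lemma halfLog_im (w : ℂ) : -Real.pi < (halfLog w).im ∧ (halfLog w).im ≤ 0 := by
  have h1 : (halfLog w).im = ((log (-w)).im - Real.pi) / 2 := by
    simp [halfLog]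
  rw [h1]
  exact ⟨by linarith [neg_pi_lt_log_im (-w)], by linarith [log_im_le_pi (-w)]⟩

/-- A quasi-periodic component of a recurrent function is an entire function of `exp (2 v)`. -/
lemma IsRecurrent.exists_entire {g : ℂ → ℂ} {b : ℂ} (h : IsRecurrent g b) {z r r' : ℂ}
    (hz : exp (Real.pi * I * z) = r) (hr : r * r' = -1) (hb : r + r' = b)
    (hzre : z.re = -(1 / 2)) :
    ∃ H : ℂ → ℂ, Differentiable ℂ H ∧ ∀ v : ℂ, |v.im| < Real.pi / 6 →
      g (v + Real.pi * I) - r' * g v = exp (z * v) * H (exp (2 * v)) := by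
  have hpi := Real.pi_pos
  set p : ℂ → ℂ := fun v => exp (-(z * v)) * (g (v + Real.pi * I) - r' * g v) with hp
  have hr0 : r ≠ 0 := hz ▸ exp_ne_zero _
  have hpd : ∀ v : ℂ, -(7 * Real.pi / 6) < v.im → v.im < Real.pi / 6 → DifferentiableAt ℂ p v :=
    fun v h1 h2 => by
    have e1 : DifferentiableAt ℂ (fun v => g (v + Real.pi * I)) v :=
      DifferentiableAt.comp (f := fun v : ℂ => v + Real.pi * I) v
        (h.diff _ (by simp [abs_lt]; constructor <;> linarith)) (by fun_prop)
    have e2 := h.diff v (abs_lt.2 ⟨h1, by linarith⟩)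
    exact DifferentiableAt.mul (by fun_prop) (e1.sub (e2.const_mul r'))
  -- Because `r` and `r'` are the characteristic roots, removing the `r'` component leaves a
  -- function multiplied by `r` under the shift, and `exp (-(z * v))` cancels that factor.
  have hper : ∀ v : ℂ, |v.im| < Real.pi / 6 → p (v - Real.pi * I) = p v := fun v hv => by
    have hj := h.jump v hv
    have e : exp (-(z * (v - Real.pi * I))) = exp (-(z * v)) * r := by
      rw [← hz, ← exp_add]; ring_nf
    simp only [hp]
    rw [e, sub_add_cancel]
    have e2 : g (v - Real.pi * I) = g (v + Real.pi * I) - (r + r') * g v := by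
      rw [hb]; linear_combination -hj
    rw [e2]
    linear_combination exp (-(z * v)) * (-g (v + Real.pi * I) + (r + r') * g v) * hr
  set H : ℂ → ℂ := fun w => p (halfLog w) with hH
  have hHp : ∀ v : ℂ, -Real.pi < v.im → v.im < Real.pi / 6 → H (exp (2 * v)) = p v :=
    fun v h1 h2 => by
    rcases le_or_gt v.im 0 with h0 | h0
    · have e : -exp (2 * v) = exp (2 * v + Real.pi * I) := by rw [exp_add, exp_pi_mul_I]; ring
      simp only [hH, halfLog]
      rw [e, log_exp (by simp; linarith) (by simp; linarith)]
      congr 1; ring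
    · have e : -exp (2 * v) = exp (2 * v - Real.pi * I) := by
        rw [exp_sub, exp_pi_mul_I]; ring
      simp only [hH, halfLog]
      rw [e, log_exp (by simp; linarith) (by simp; linarith),
        ← hper v (abs_lt.2 ⟨by linarith, h2⟩)]
      congr 1; ring
  have hHd : ∀ w : ℂ, w ≠ 0 → DifferentiableAt ℂ H w := fun w hw => by
    -- `halfLog` jumps across the positive axis. `L` is a local analytic branch through the same
    -- point, and by `hHp` the choice of branch does not affect `p`.
    set L : ℂ → ℂ := fun w' => halfLog w + log (w' / w) / 2 with hL
    have hLw : L w = halfLog w := by simp [hL, hw]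
    have hLd : DifferentiableAt ℂ L w := by
      have : w / w ∈ slitPlane := by rw [div_self hw]; exact one_mem_slitPlane
      have h1 : DifferentiableAt ℂ (fun w' : ℂ => w' / w) w := differentiableAt_id.div_const w
      exact ((h1.clog this).div_const 2).const_add _
    obtain ⟨hi1, hi2⟩ := halfLog_im w
    have hev : (fun w' => p (L w')) =ᶠ[𝓝 w] H := by
      have hc : ContinuousAt (fun w' => (L w').im) w :=
        continuous_im.continuousAt.comp hLd.continuousAt
      have hmem : (L w).im ∈ Ioo (-Real.pi) (Real.pi / 6) := by
        rw [hLw]; exact ⟨hi1, by linarith⟩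
      filter_upwards [hc.eventually_mem (isOpen_Ioo.mem_nhds hmem), isOpen_ne.mem_nhds hw]
        with w' hw' hne
      rw [← hHp _ hw'.1 hw'.2]
      congr 1
      simp only [hL]
      rw [mul_add, exp_add, exp_two_halfLog hw, mul_div_cancel₀ _ two_ne_zero,
        exp_log (div_ne_zero hne hw), mul_div_cancel₀ _ hw]
    refine DifferentiableAt.congr_of_eventuallyEq ?_ hev.symm
    refine DifferentiableAt.comp (g := p) w ?_ hLd
    rw [hLw]
    exact hpd _ (by linarith) (by linarith)
  have hH0 : Tendsto (fun w => w * H w) (𝓝[≠] 0) (𝓝 0) := by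
    obtain ⟨B, hB, hg⟩ := h.bound
    set C := Real.exp (|z.im| * Real.pi) * (B + ‖r'‖ * B) with hC
    -- With `ρ = Re v`, the factors `w`, `exp (-(z * v))` and `g` contribute `e^{2ρ}`, `e^{ρ/2}` and
    -- `e^{-ρ}`; their product `e^{3ρ/2}` is at most `e^ρ = √‖w‖`.
    have hbd : ∀ w : ℂ, w ≠ 0 → ‖w‖ ≤ 1 → ‖w * H w‖ ≤ C * √‖w‖ := fun w hw hw1 => by
      obtain ⟨hi1, hi2⟩ := halfLog_im w
      set v := halfLog w with hv
      have hwv : ‖w‖ = Real.exp (2 * v.re) := by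
        conv_lhs => rw [← exp_two_halfLog hw]
        rw [Complex.norm_exp]; simp [hv]
      have hre : v.re ≤ 0 := by
        rw [hwv, Real.exp_le_one_iff] at hw1; linarith
      have h1 : ‖p v‖ ≤ Real.exp (v.re / 2 + |z.im| * Real.pi) *
          (B * Real.exp (-v.re) + ‖r'‖ * (B * Real.exp (-v.re))) := by
        simp only [hp]
        rw [norm_mul, Complex.norm_exp]
        have e1 : (-(z * v)).re ≤ v.re / 2 + |z.im| * Real.pi := by
          rw [neg_re, mul_re, hzre]
          have : z.im * v.im ≤ |z.im| * Real.pi :=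
            (le_abs_self _).trans (by rw [abs_mul]; gcongr; rw [abs_le]; constructor <;> linarith)
          linarith
        have e2 : ‖g (v + Real.pi * I)‖ ≤ B * Real.exp (-v.re) := by
          have := hg (v + Real.pi * I) (by simp [abs_le]; constructor <;> linarith) (by simpa)
          simpa using this
        have e3 := hg v (abs_le.2 ⟨hi1.le, by linarith⟩) hre
        gcongr
        refine (norm_sub_le _ _).trans (add_le_add e2 ?_)
        rw [norm_mul]
        gcongr
      have h2 : √‖w‖ = Real.exp v.re := by
        rw [hwv, two_mul, Real.exp_add, Real.sqrt_mul_self (Real.exp_pos _).le]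
      rw [norm_mul, h2, hwv]
      calc _ ≤ Real.exp (2 * v.re) * (Real.exp (v.re / 2 + |z.im| * Real.pi) *
          (B * Real.exp (-v.re) + ‖r'‖ * (B * Real.exp (-v.re)))) := by gcongr
        _ = C * Real.exp (2 * v.re + v.re / 2 + -v.re) := by
          rw [Real.exp_add, Real.exp_add, Real.exp_add, hC]; ring
        _ ≤ _ := by
          gcongr
          linarith
    have hlim : Tendsto (fun w : ℂ => C * √‖w‖) (𝓝[≠] 0) (𝓝 0) := by
      have : Continuous fun w : ℂ => C * √‖w‖ := by fun_prop
      simpa using (this.tendsto 0).mono_left nhdsWithin_le_nhds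
    refine squeeze_zero_norm' ?_ hlim
    filter_upwards [self_mem_nhdsWithin,
      mem_nhdsWithin_of_mem_nhds (Metric.closedBall_mem_nhds (0 : ℂ) one_pos)] with w hw hw1
    exact hbd w hw (by simpa using hw1)
  refine ⟨Function.update H 0 (limUnder (𝓝[≠] 0) H), ?_, fun v hv => ?_⟩
  · rw [← differentiableOn_univ]
    refine differentiableOn_update_limUnder_of_isLittleO univ_mem
      (fun w hw => (hHd w hw.2).differentiableWithinAt) ?_
    refine (isLittleO_iff_tendsto' ?_).2 ?_
    · filter_upwards [self_mem_nhdsWithin] with y hy h0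
      exact absurd (inv_eq_zero.1 h0) (sub_ne_zero.2 hy)
    · have h6 : Tendsto (fun y : ℂ => y * H 0) (𝓝[≠] 0) (𝓝 0) := by
        have : Continuous fun y : ℂ => y * H 0 := by fun_prop
        simpa using (this.tendsto (0 : ℂ)).mono_left nhdsWithin_le_nhds
      have h7 := hH0.sub h6
      rw [sub_zero] at h7
      refine h7.congr fun y => ?_
      rw [div_inv_eq_mul, sub_zero]; ring
  · rw [abs_lt] at hv
    rw [Function.update_of_ne (exp_ne_zero _), hHp v (by linarith) hv.2, hp, ← mul_assoc,
      ← exp_add, add_neg_cancel, exp_zero, one_mul]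

/-! ### The exponent `θ` and the characteristic roots -/

lemma one_lt_pi_div {lam : ℝ} (h0 : 0 < lam) (hpi : lam < Real.pi) :
    1 < Real.pi / lam := by rwa [one_lt_div h0]

lemma sqrt_lt_pi_div {lam : ℝ} (h0 : 0 < lam) (hpi : lam < Real.pi) :
    √((Real.pi / lam) ^ 2 - 1) < Real.pi / lam := by
  have h := one_lt_pi_div h0 hpi
  rw [Real.sqrt_lt' (by linarith)]
  linarith

lemma exp_pi_theta {lam : ℝ} (h0 : 0 < lam) (hpi : lam < Real.pi) :
    Real.exp (Real.pi * theta lam) =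
    Real.pi / lam - √((Real.pi / lam) ^ 2 - 1) := by
  rw [theta, ← mul_assoc, mul_one_div_cancel Real.pi_ne_zero, one_mul,
    Real.exp_log (sub_pos.2 (sqrt_lt_pi_div h0 hpi))]

lemma exp_neg_pi_theta {lam : ℝ} (h0 : 0 < lam) (hpi : lam < Real.pi) :
    Real.exp (-(Real.pi * theta lam)) =
    Real.pi / lam + √((Real.pi / lam) ^ 2 - 1) := by
  have h := one_lt_pi_div h0 hpi
  have h1 : 0 ≤ (Real.pi / lam) ^ 2 - 1 := by nlinarith
  rw [Real.exp_neg, exp_pi_theta h0 hpi]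
  refine inv_eq_of_mul_eq_one_right ?_
  have := Real.sq_sqrt h1
  linear_combination -this

lemma theta_ne_zero {lam : ℝ} (h0 : 0 < lam) (hpi : lam < Real.pi) :
    theta lam ≠ 0 := fun h => by
  have h1 := exp_pi_theta h0 hpi
  have h2 := exp_neg_pi_theta h0 hpi
  have h3 := one_lt_pi_div h0 hpi
  have h4 : 0 < √((Real.pi / lam) ^ 2 - 1) := Real.sqrt_pos.2 (by nlinarith)
  rw [h] at h1 h2
  simp only [mul_zero, neg_zero, Real.exp_zero] at h1 h2
  linarith

/-- With `e^{πθ} + e^{-πθ} = 2π/lam`, the values at `θ` and `-θ` are the two roots of `r² +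
(2πi/lam) r - 1 = 0`. -/
lemma exp_pi_mul_exponent (θ : ℝ) :
    exp (Real.pi * I * (-(1 / 2) - I * θ)) = -I * (Real.exp (Real.pi * θ) : ℝ) := by
  have : (Real.pi * I * (-(1 / 2) - I * θ) : ℂ) = -(Real.pi / 2 * I) + (Real.pi * θ : ℝ) := by
    push_cast
    linear_combination (-(Real.pi : ℂ) * θ) * I_mul_I
  rw [this, exp_add, exp_neg, exp_pi_div_two_mul_I, inv_I, ofReal_exp]

/-- Two oscillating exponentials with opposite frequencies are independent at infinity. -/
lemma oscillating_coeff_eq_zero {θ : ℝ} (hθ : θ ≠ 0) {p q : ℂ}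
    (h : Tendsto (fun s : ℝ => p * exp (-(I * θ) * s) + q * exp (I * θ * s)) atBot (𝓝 0)) :
    p = 0 ∧ q = 0 := by
  -- Translation by `τ` multiplies the two exponentials by `-i` and `i`, so combining with the
  -- original isolates each one; its modulus is constant and tends to `0`.
  set τ : ℝ := Real.pi / (2 * θ) with hτ
  have hθ' : (θ : ℂ) ≠ 0 := by exact_mod_cast hθ
  have e1 : exp (I * θ * τ) = I := by
    have : I * θ * τ = Real.pi / 2 * I := by rw [hτ]; push_cast; field_simp
    rw [this, exp_pi_div_two_mul_I]
  have e2 : exp (-(I * θ) * τ) = -I := by rw [neg_mul, exp_neg, e1, inv_I]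
  have h2 : Tendsto (fun s : ℝ => -I * p * exp (-(I * θ) * s) + I * q * exp (I * θ * s))
      atBot (𝓝 0) := by
    refine (h.comp (tendsto_atBot_add_const_right atBot τ tendsto_id)).congr fun s => ?_
    simp only [Function.comp_apply, id, ofReal_add, mul_add, exp_add, e1, e2]
    ring
  have hn1 : ∀ s : ℝ, ‖exp (-(I * θ) * s)‖ = 1 := fun s => by
    rw [Complex.norm_exp]; simp
  have hn2 : ∀ s : ℝ, ‖exp (I * θ * s)‖ = 1 := fun s => by
    rw [Complex.norm_exp]; simp
  have a1 := (h.add (h2.const_mul I)).norm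
  have a2 := (h.sub (h2.const_mul I)).norm
  have b1 : ∀ s : ℝ, ‖p * exp (-(I * θ) * s) + q * exp (I * θ * s) +
      I * (-I * p * exp (-(I * θ) * s) + I * q * exp (I * θ * s))‖ = 2 * ‖p‖ := fun s => by
    have : p * exp (-(I * θ) * s) + q * exp (I * θ * s) +
      I * (-I * p * exp (-(I * θ) * s) + I * q * exp (I * θ * s)) =
        2 * p * exp (-(I * θ) * s) := by
      linear_combination (-p * exp (-(I * θ) * s) + q * exp (I * θ * s)) * I_mul_I
    rw [this, norm_mul, hn1, norm_mul]; simp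
  have b2 : ∀ s : ℝ, ‖p * exp (-(I * θ) * s) + q * exp (I * θ * s) -
      I * (-I * p * exp (-(I * θ) * s) + I * q * exp (I * θ * s))‖ = 2 * ‖q‖ := fun s => by
    have : p * exp (-(I * θ) * s) + q * exp (I * θ * s) -
      I * (-I * p * exp (-(I * θ) * s) + I * q * exp (I * θ * s)) =
        2 * q * exp (I * θ * s) := by
      linear_combination (p * exp (-(I * θ) * s) - q * exp (I * θ * s)) * I_mul_I
    rw [this, norm_mul, hn2, norm_mul]; simp
  simp only [b1, mul_zero, add_zero, norm_zero] at a1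
  simp only [b2, mul_zero, sub_zero, norm_zero] at a2
  have c1 := tendsto_nhds_unique tendsto_const_nhds a1
  have c2 := tendsto_nhds_unique tendsto_const_nhds a2
  exact ⟨by simpa using c1, by simpa using c2⟩

/-! ### Splitting a solution into its two quasi-periodic parts -/

namespace IsSolution

variable {lam : ℝ} {c : ℂ} {G : ℂ → ℂ}

lemma isRecurrent (h : IsSolution lam c G) :
    IsRecurrent (logCont lam c G) (-(2 * Real.pi * I / lam)) :=
  ⟨fun _ hv => h.differentiableAt_logCont hv, h.norm_logCont_le, fun _ hv => h.logCont_jump hv⟩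

/-- Subtracting `g(v + πi) - r g(v)` from `g(v + πi) - r' g(v)` leaves `(r - r') g(v)`, and `r ≠ r'`
since `θ ≠ 0`. -/
lemma exists_entire_pair (h : IsSolution lam c G) (hlam : lam < Real.pi) :
    ∃ H₁ H₂ : ℂ → ℂ, Differentiable ℂ H₁ ∧ Differentiable ℂ H₂ ∧
      ∀ v : ℂ, |v.im| < Real.pi / 6 → G (exp v) =
        exp ((-(1 / 2) - I * theta lam) * v) * H₁ (exp (2 * v)) +
        exp ((-(1 / 2) + I * theta lam) * v) * H₂ (exp (2 * v)) := by
  have h0 := h.pos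
  set θ := theta lam with hθ
  have hz2 : exp (Real.pi * I * (-(1 / 2) + I * θ)) =
      -I * (Real.exp (-(Real.pi * θ)) : ℝ) := by
    have := exp_pi_mul_exponent (-θ)
    rw [mul_neg] at this
    rw [← this]
    push_cast
    ring_nf
  have hprod : (Real.exp (Real.pi * θ) : ℂ) * (Real.exp (-(Real.pi * θ)) : ℝ) = 1 := by
    rw [← ofReal_mul, ← Real.exp_add, add_neg_cancel, Real.exp_zero, ofReal_one]
  have hsum : (Real.exp (Real.pi * θ) : ℂ) + (Real.exp (-(Real.pi * θ)) : ℝ) =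
      2 * Real.pi / lam := by
    rw [exp_pi_theta h0 hlam, exp_neg_pi_theta h0 hlam]
    push_cast
    ring
  have hne : (Real.exp (-(Real.pi * θ)) : ℂ) - (Real.exp (Real.pi * θ) : ℝ) ≠ 0 := by
    rw [sub_ne_zero]
    intro h1
    have h2 := Real.exp_injective (ofReal_injective h1)
    have h3 := theta_ne_zero h0 hlam
    have h4 : Real.pi * θ = 0 := by linarith
    exact h3 ((mul_eq_zero.1 h4).resolve_left Real.pi_ne_zero)
  set e := (Real.exp (Real.pi * θ) : ℂ)
  set e' := (Real.exp (-(Real.pi * θ)) : ℂ)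
  obtain ⟨H₁, hd1, hH1⟩ := h.isRecurrent.exists_entire (z := -(1 / 2) - I * θ) (r' := -I * e')
    (exp_pi_mul_exponent θ) (by linear_combination e * e' * I_mul_I - hprod)
    (by linear_combination -I * hsum) (by simp)
  obtain ⟨H₂, hd2, hH2⟩ := h.isRecurrent.exists_entire (z := -(1 / 2) + I * θ) (r' := -I * e)
    hz2 (by linear_combination e * e' * I_mul_I - hprod)
    (by linear_combination -I * hsum) (by simp)
  set k : ℂ := (I * (e' - e))⁻¹ with hk
  have hk1 : k * (I * (e' - e)) = 1 := inv_mul_cancel₀ (mul_ne_zero I_ne_zero hne)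
  refine ⟨fun w => k * H₁ w, fun w => -k * H₂ w, hd1.const_mul _, hd2.const_mul _,
    fun v hv => ?_⟩
  rw [← h.logCont_eq (v := v) (by linarith [Real.pi_pos])]
  linear_combination k * hH1 v hv - k * hH2 v hv - logCont lam c G v * hk1

/-- As `s → -∞`, `e^{s/2} G(e^s)` is `H₁(0) e^{-iθs} + H₂(0) e^{iθs} + o(1)` and tends to `0`. So
both constants vanish, and a factor `e^{2v}` splits off each `H`. -/
theorem exists_decomposition (h : IsSolution lam c G) (hlam : lam < Real.pi)
    (hG : Tendsto (fun x : ℝ => (√x : ℂ) * G x) (𝓝[>] 0) (𝓝 0)) :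
    ∃ J₁ J₂ : ℂ → ℂ, Differentiable ℂ J₁ ∧ Differentiable ℂ J₂ ∧
      ∀ v : ℂ, |v.im| < Real.pi / 6 → G (exp v) =
        exp ((3 / 2 - I * theta lam) * v) * J₁ (exp (2 * v)) +
        exp ((3 / 2 + I * theta lam) * v) * J₂ (exp (2 * v)) := by
  obtain ⟨H₁, H₂, hd1, hd2, hH⟩ := h.exists_entire_pair hlam
  set θ := theta lam with hθ
  have hexp : Tendsto (fun s : ℝ => exp (2 * (s : ℂ))) atBot (𝓝 0) := by
    have h1 : Tendsto (fun s : ℝ => Real.exp (2 * s)) atBot (𝓝 0) :=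
      Real.tendsto_exp_atBot.comp (tendsto_id.const_mul_atBot two_pos)
    have h2 := (continuous_ofReal.tendsto 0).comp h1
    rw [ofReal_zero] at h2
    exact h2.congr fun s => by simp
  have hlim : ∀ (H : ℂ → ℂ), Differentiable ℂ H → ∀ b : ℂ, b.re = 0 →
      Tendsto (fun s : ℝ => (H (exp (2 * s)) - H 0) * exp (b * s)) atBot (𝓝 0) :=
    fun H hd b hb => by
    have h1 : Tendsto (fun s : ℝ => ‖H (exp (2 * s)) - H 0‖) atBot (𝓝 0) := by
      have := ((hd.continuous.tendsto 0).comp hexp).sub_const (H 0)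
      rw [sub_self] at this
      simpa using this.norm
    refine squeeze_zero_norm (fun s => le_of_eq ?_) h1
    rw [norm_mul, Complex.norm_exp]
    simp [hb]
  have h1 : Tendsto (fun s : ℝ => (√(Real.exp s) : ℂ) * G (Real.exp s : ℝ)) atBot (𝓝 0) :=
    hG.comp (tendsto_nhdsWithin_iff.2 ⟨Real.tendsto_exp_atBot,
      Eventually.of_forall fun s => Real.exp_pos s⟩)
  have h2 : Tendsto (fun s : ℝ => H₁ 0 * exp (-(I * θ) * s) + H₂ 0 * exp (I * θ * s))
      atBot (𝓝 0) := by
    have h3 := (h1.sub (hlim H₁ hd1 (-(I * θ)) (by simp))).sub (hlim H₂ hd2 (I * θ) (by simp))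
    simp only [sub_zero] at h3
    refine h3.congr fun s => ?_
    have e1 : (√(Real.exp s) : ℂ) = exp (1 / 2 * s) := by
      rw [← Real.exp_half]; push_cast; ring_nf
    rw [e1, ofReal_exp, hH s (by simp [Real.pi_pos]), mul_add, ← mul_assoc, ← mul_assoc,
      ← exp_add, ← exp_add]
    ring_nf
  obtain ⟨hp, hq⟩ := oscillating_coeff_eq_zero (theta_ne_zero h.pos hlam) h2
  have hfac : ∀ H : ℂ → ℂ, Differentiable ℂ H → H 0 = 0 →
      Differentiable ℂ (dslope H 0) ∧ ∀ w, H w = w * dslope H 0 w := fun H hd h0 => by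
    refine ⟨?_, fun w => ?_⟩
    · rw [← differentiableOn_univ] at hd ⊢
      exact (differentiableOn_dslope univ_mem).2 hd
    · have := sub_smul_dslope H 0 w
      rw [sub_zero, h0, sub_zero, smul_eq_mul] at this
      exact this.symm
  obtain ⟨hJ1, e1⟩ := hfac H₁ hd1 hp
  obtain ⟨hJ2, e2⟩ := hfac H₂ hd2 hq
  refine ⟨_, _, hJ1, hJ2, fun v hv => ?_⟩
  rw [hH v hv, e1, e2, ← mul_assoc, ← mul_assoc, ← exp_add, ← exp_add]
  ring_nf

end IsSolution

/-! ### Dirichlet series with square-summable coefficients -/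

/-- Cauchy–Schwarz. The sequence `b` is arbitrary so that tails of the coefficients can be inserted.
-/
lemma tsum_mul_rpow_le {b : ℕ → ℝ} (hb0 : ∀ n, 0 ≤ b n) (hb : Summable fun n => b n ^ 2) {σ : ℝ}
    (hσ : 0 < σ) :
    (Summable fun n : ℕ => b n * ((n : ℝ) + 2) ^ (-(σ + 1 / 2))) ∧
      ∑' n : ℕ, b n * ((n : ℝ) + 2) ^ (-(σ + 1 / 2)) ≤
        √(∑' n, b n ^ 2) * √(σ⁻¹ * Real.exp (-(σ / 2))) := by
  have e : ∀ n : ℕ, (((n : ℝ) + 2) ^ (-(σ + 1 / 2))) ^ (2 : ℝ) =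
      ((n : ℝ) + 2) ^ (-(1 + 2 * σ)) := fun n => by
    rw [← Real.rpow_mul (by positivity)]; congr 1; ring
  have h2 : 0 < 2 * σ := by positivity
  have hs := summable_nat_add_two_rpow h2
  obtain ⟨h3, h4⟩ := Real.summable_and_inner_le_Lp_mul_Lq_tsum_of_nonneg
    Real.HolderConjugate.two_two hb0
    (fun n : ℕ => (by positivity : 0 ≤ ((n : ℝ) + 2) ^ (-(σ + 1 / 2))))
    (by simpa using hb) (by simpa only [e] using hs)
  refine ⟨h3, h4.trans ?_⟩
  simp only [e, Real.rpow_two, ← Real.sqrt_eq_rpow]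
  gcongr
  refine (tsum_nat_add_two_rpow_le h2).trans (le_of_eq ?_)
  rw [show 2 * σ / 4 = σ / 2 by ring, mul_comm 2 σ, div_mul_cancel_right₀ two_ne_zero]

/-- `f` is a Dirichlet series with coefficients `a`, vanishing at `0` and `1` and square-summable. -/
structure HasCoeffs (f : ℂ → ℂ) (a : ℕ → ℂ) : Prop where
  zero : a 0 = 0
  one : a 1 = 0
  summable : Summable fun n => ‖a n‖ ^ 2
  hasSum : ∀ s ∈ halfPlane, LSeriesHasSum a s (f s)

namespace HasCoeffs

variable {f : ℂ → ℂ} {a : ℕ → ℂ}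

lemma summable_shift (h : HasCoeffs f a) : Summable fun n => ‖a (n + 2)‖ ^ 2 :=
  (summable_nat_add_iff 2).2 h.summable

lemma add_half_mem {y : ℂ} (hy : 0 < y.re) : y + 1 / 2 ∈ halfPlane := by
  have h1 : (y + 1 / 2).re = y.re + 1 / 2 := by
    rw [add_re]; norm_num
  change 1 / 2 < (y + 1 / 2).re
  rw [h1]; linarith

lemma isOpen_halfPlane : IsOpen halfPlane := isOpen_lt continuous_const continuous_re

lemma hasSum_shift (h : HasCoeffs f a) {y : ℂ} (hy : 0 < y.re) :
    HasSum (fun n : ℕ => a (n + 2) * ((n : ℂ) + 2) ^ (-(y + 1 / 2))) (f (y + 1 / 2)) := by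
  have h1 : HasSum (LSeries.term a (y + 1 / 2)) (f (y + 1 / 2)) := h.hasSum _ (add_half_mem hy)
  have h2 := (hasSum_nat_add_iff' 2).2 h1
  rw [Finset.sum_range_succ, Finset.sum_range_one, LSeries.term_def₀ h.zero,
    LSeries.term_def₀ h.zero, h.zero, h.one] at h2
  simp only [zero_mul, add_zero, sub_zero] at h2
  refine h2.congr_fun fun n => ?_
  rw [LSeries.term_def₀ h.zero]
  push_cast
  rfl

lemma norm_term (a : ℕ → ℂ) (n : ℕ) (y : ℂ) :
    ‖a (n + 2) * ((n : ℂ) + 2) ^ (-(y + 1 / 2))‖ =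
      ‖a (n + 2)‖ * ((n : ℝ) + 2) ^ (-(y.re + 1 / 2)) := by
  have h1 : (-(y + 1 / 2)).re = -(y.re + 1 / 2) := by
    rw [neg_re, add_re]; norm_num
  rw [norm_mul, norm_nat_add_two_cpow, h1]

lemma norm_le (h : HasCoeffs f a) : ∃ A, 0 ≤ A ∧ ∀ y : ℂ, 0 < y.re →
    ‖f (y + 1 / 2)‖ ≤ A * √(y.re⁻¹ * Real.exp (-(y.re / 2))) := by
  refine ⟨√(∑' n, ‖a (n + 2)‖ ^ 2), Real.sqrt_nonneg _, fun y hy => ?_⟩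
  obtain ⟨h1, h2⟩ := tsum_mul_rpow_le (fun n => norm_nonneg (a (n + 2))) h.summable_shift hy
  rw [← (h.hasSum_shift hy).tsum_eq]
  exact (tsum_of_norm_bounded h1.hasSum fun n => (norm_term a n y).le).trans h2

lemma norm_le_rpow (h : HasCoeffs f a) : ∃ A, 0 ≤ A ∧ ∀ y : ℂ, 0 < y.re →
    ‖f (y + 1 / 2)‖ ≤ A * y.re ^ (-(1 / 2) : ℝ) := by
  obtain ⟨A, hA, hf⟩ := h.norm_le
  refine ⟨A, hA, fun y hy => (hf y hy).trans ?_⟩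
  gcongr
  rw [Real.rpow_neg hy.le, ← Real.sqrt_eq_rpow, ← Real.sqrt_inv]
  refine Real.sqrt_le_sqrt (mul_le_of_le_one_right (by positivity) ?_)
  rw [Real.exp_le_one_iff]
  linarith

lemma differentiableOn (h : HasCoeffs f a) : DifferentiableOn ℂ f halfPlane := by
  have h1 : LSeries.abscissaOfAbsConv a ≤ ((1 / 2 : ℝ) : EReal) :=
    LSeries.abscissaOfAbsConv_le_of_forall_lt_LSeriesSummable fun y hy =>
      (h.hasSum y (by simpa [halfPlane] using hy)).LSeriesSummable
  have h2 : DifferentiableOn ℂ (LSeries a) halfPlane :=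
    (LSeries_differentiableOn a).mono fun s hs =>
      h1.trans_lt (EReal.coe_lt_coe_iff.2 hs)
  exact h2.congr fun s hs => (h.hasSum s hs).LSeries_eq.symm

lemma differentiableOn_shift (h : HasCoeffs f a) :
    DifferentiableOn ℂ (fun y => f (y + 1 / 2)) {y | 0 < y.re} :=
  h.differentiableOn.comp (by fun_prop) fun _ hy => add_half_mem hy

/-- Square-summability forces growth slower than `x ^ (-1/2)` at the boundary point. -/
lemma tendsto_sqrt_mul (h : HasCoeffs f a) :
    Tendsto (fun x : ℝ => (√x : ℂ) * f (x + 1 / 2)) (𝓝[>] 0) (𝓝 0) := by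
  rw [Metric.tendsto_nhds]
  intro ε hε
  have htail := tendsto_sum_nat_add fun n => ‖a (n + 2)‖ ^ 2
  -- The first `N` terms stay bounded by `C` and are killed by `√x`; the tail has `ℓ²` norm below
  -- `ε/2`, and Cauchy–Schwarz costs only `x^{-1/2}`.
  obtain ⟨N, hN⟩ := (htail.eventually (gt_mem_nhds (show 0 < (ε / 2) ^ 2 by positivity))).exists
  set C := ∑ n ∈ Finset.range N, ‖a (n + 2)‖ with hC
  have hC0 : 0 ≤ C := Finset.sum_nonneg fun n _ => norm_nonneg _
  have hlim : Tendsto (fun x : ℝ => √x * C) (𝓝[>] 0) (𝓝 0) := by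
    have : Continuous fun x : ℝ => √x * C := by fun_prop
    simpa using (this.tendsto 0).mono_left nhdsWithin_le_nhds
  filter_upwards [hlim.eventually (gt_mem_nhds (half_pos hε)), self_mem_nhdsWithin] with x hxC hx
  have hx0 : 0 < x := hx
  have hs := h.hasSum_shift (y := x) (by simpa using hx0)
  have hs2 := (hasSum_nat_add_iff' N).2 hs
  obtain ⟨h1, h2⟩ := tsum_mul_rpow_le (b := fun n => ‖a (n + N + 2)‖)
    (fun n => norm_nonneg _) ((summable_nat_add_iff N).2 h.summable_shift) hx0
  have h3 : ‖f (x + 1 / 2) - ∑ n ∈ Finset.range N,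
      a (n + 2) * ((n : ℂ) + 2) ^ (-((x : ℂ) + 1 / 2))‖ ≤ ε / 2 * √(x⁻¹) := by
    rw [← hs2.tsum_eq]
    refine (tsum_of_norm_bounded h1.hasSum fun n => ?_).trans (h2.trans ?_)
    · rw [norm_term, ofReal_re]
      gcongr ?_ * ?_
      refine Real.rpow_le_rpow_of_nonpos (by positivity) ?_ (by linarith)
      push_cast
      linarith [(Nat.cast_nonneg N : (0 : ℝ) ≤ N)]
    · refine mul_le_mul ?_ ?_ (Real.sqrt_nonneg _) (by positivity)
      · rw [Real.sqrt_le_left (by positivity)]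
        exact hN.le
      · refine Real.sqrt_le_sqrt (mul_le_of_le_one_right (by positivity) ?_)
        rw [Real.exp_le_one_iff]
        linarith
  have h4 : ‖∑ n ∈ Finset.range N, a (n + 2) * ((n : ℂ) + 2) ^ (-((x : ℂ) + 1 / 2))‖ ≤ C := by
    refine (norm_sum_le _ _).trans (Finset.sum_le_sum fun n _ => ?_)
    rw [norm_term, ofReal_re]
    refine mul_le_of_le_one_right (norm_nonneg _) ?_
    refine Real.rpow_le_one_of_one_le_of_nonpos ?_ (by linarith)
    linarith [(Nat.cast_nonneg n : (0 : ℝ) ≤ n)]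
  have h5 : ‖f (x + 1 / 2)‖ ≤ ε / 2 * √(x⁻¹) + C := by
    have := norm_add_le (f (x + 1 / 2) - ∑ n ∈ Finset.range N,
      a (n + 2) * ((n : ℂ) + 2) ^ (-((x : ℂ) + 1 / 2)))
      (∑ n ∈ Finset.range N, a (n + 2) * ((n : ℂ) + 2) ^ (-((x : ℂ) + 1 / 2)))
    rw [sub_add_cancel] at this
    linarith
  rw [dist_zero_right, norm_mul, Complex.norm_of_nonneg (Real.sqrt_nonneg x)]
  have h6 : √x * √(x⁻¹) = 1 := by
    rw [← Real.sqrt_mul hx0.le, mul_inv_cancel₀ hx0.ne', Real.sqrt_one]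
  calc _ ≤ √x * (ε / 2 * √(x⁻¹) + C) := by gcongr
    _ = ε / 2 * (√x * √(x⁻¹)) + √x * C := by ring
    _ < ε := by rw [h6]; linarith

end HasCoeffs

lemma MemH20.exists_hasCoeffs {f : ℂ → ℂ} (hf : MemH20 f) : ∃ a, HasCoeffs f a := by
  obtain ⟨a, h0, h1, h2, h3⟩ := hf
  exact ⟨a, h0, h1, h2, h3⟩

/-! ### The integral equation in centred coordinates -/

lemma integrableOn_mul_kernel {Φ : ℝ → ℂ} (hc : ContinuousOn Φ (Ioi 0)) {M : ℝ}
    (hΦ : ∀ y, 0 < y → ‖Φ y‖ ≤ M * (1 + y ^ (-(1 / 2) : ℝ))) {x : ℝ} (hx : 0 < x) :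
    IntegrableOn (fun y : ℝ => Φ y * kernel (y + x)) (Ioi 0) := by
  have h1 := integrableOn_rpow_mul_exp_neg_mul_rpow (p := 1) (s := 0) (b := 1 / 4)
    (by norm_num) one_pos (by norm_num)
  have h2 := integrableOn_rpow_mul_exp_neg_mul_rpow (p := 1) (s := -(1 / 2)) (b := 1 / 4)
    (by norm_num) one_pos (by norm_num)
  refine Integrable.mono' ((h1.add h2).const_mul (M * (2 / x))) ?_ ?_
  · refine ContinuousOn.aestronglyMeasurable (hc.mul fun y hy => ?_) measurableSet_Ioi
    refine ContinuousAt.continuousWithinAt (ContinuousAt.comp (f := fun y : ℝ => (y : ℂ) + x)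
      (differentiableAt_kernel ?_).continuousAt (by fun_prop))
    exact_mod_cast (add_pos (mem_Ioi.1 hy) hx).ne'
  · filter_upwards [ae_restrict_mem measurableSet_Ioi] with y hy
    have hy0 : 0 < y := hy
    have hre : ((y : ℂ) + x).re = y + x := by simp
    have hk : ‖kernel (y + x)‖ ≤ 2 / x * Real.exp (-(y / 4)) := by
      refine (norm_kernel_le (by rw [hre]; positivity)).trans ?_
      rw [hre]
      gcongr <;> linarith
    have he : Real.exp (-(1 / 4) * y ^ (1 : ℝ)) = Real.exp (-(y / 4)) := by
      rw [Real.rpow_one]; congr 1; ring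
    simp only [Pi.add_apply, he, Real.rpow_zero]
    have hM : 0 ≤ M * (1 + y ^ (-(1 / 2) : ℝ)) := (norm_nonneg _).trans (hΦ y hy0)
    rw [norm_mul]
    calc _ ≤ (M * (1 + y ^ (-(1 / 2) : ℝ))) * (2 / x * Real.exp (-(y / 4))) := by
          gcongr
          exact hΦ y hy0
      _ = _ := by ring

lemma setIntegral_Ioi_shift (g : ℝ → ℂ) :
    ∫ w in Ioi (1 / 2 : ℝ), g w = ∫ y in Ioi (0 : ℝ), g (y + 1 / 2) := by
  have h := (measurePreserving_add_right volume (1 / 2 : ℝ)).setIntegral_preimage_emb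
    (measurableEmbedding_addRight (1 / 2 : ℝ)) g (Ioi (1 / 2))
  rw [preimage_add_const_Ioi, sub_self] at h
  exact h.symm

lemma opH_add_half (f : ℂ → ℂ) (x : ℂ) :
    opH f (x + 1 / 2) = ∫ y in Ioi (0 : ℝ), f (y + 1 / 2) * kernel (y + x) := by
  rw [opH, setIntegral_Ioi_shift]
  refine setIntegral_congr_fun measurableSet_Ioi fun y _ => ?_
  simp only [kernel]
  push_cast
  congr 3
  ring

/-- Termwise integration of the series of `K`: `∫₀^∞ n^{-(1+x+y)} dy = n^{-(1+x)} / log n`, and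
`n^{-(1+x)} = n^{-1/2} n^{-(x+1/2)}`. -/
lemma symbol_add_half {x : ℝ} (hx : 0 < x) :
    symbol (x + 1 / 2) = ∫ y in Ioi (0 : ℝ), kernel (y + x) := by
  set F : ℕ → ℝ → ℝ := fun n y =>
    ((n : ℝ) + 2) ^ (-(1 + x)) * Real.exp (-Real.log ((n : ℝ) + 2) * y) with hF
  have hlog : ∀ n : ℕ, Real.log 2 ≤ Real.log ((n : ℝ) + 2) := fun n =>
    Real.log_le_log (by norm_num) (by linarith [(Nat.cast_nonneg n : (0 : ℝ) ≤ n)])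
  have hlog2 : 0 < Real.log 2 := Real.log_pos (by norm_num)
  have hpos : ∀ n : ℕ, 0 < Real.log ((n : ℝ) + 2) := fun n => hlog2.trans_le (hlog n)
  have hint : ∀ n, IntegrableOn (F n) (Ioi 0) := fun n =>
    (integrableOn_exp_mul_Ioi (neg_neg_of_pos (hpos n)) 0).const_mul _
  have hval : ∀ n, ∫ y in Ioi (0 : ℝ), F n y =
      ((n : ℝ) + 2) ^ (-(1 + x)) / Real.log ((n : ℝ) + 2) := fun n => by
    simp only [hF]
    rw [integral_const_mul, integral_exp_mul_Ioi (neg_neg_of_pos (hpos n))]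
    simp [div_eq_mul_inv]
  have hnn : ∀ n y, 0 ≤ F n y := fun n y => by positivity
  have key := hasSum_integral_of_summable_integral_norm (μ := volume.restrict (Ioi (0 : ℝ)))
    (F := fun n y => ((F n y : ℝ) : ℂ)) (fun n => (hint n).ofReal) ?_
  · have h1 : ∫ y in Ioi (0 : ℝ), ∑' n, ((F n y : ℝ) : ℂ) =
        ∫ y in Ioi (0 : ℝ), kernel (y + x) := by
      refine setIntegral_congr_fun measurableSet_Ioi fun y hy => ?_
      have hy0 : 0 < y := hy
      have h2 := hasSum_kernel (u := (y : ℂ) + x) (by simpa using add_pos hy0 hx)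
      rw [← h2.tsum_eq]
      refine tsum_congr fun n => ?_
      have e1 : ((n : ℂ) + 2) = (((n : ℝ) + 2 : ℝ) : ℂ) := by push_cast; rfl
      have e2 : (-(1 + ((y : ℂ) + x))) = ((-(1 + (y + x)) : ℝ) : ℂ) := by push_cast; rfl
      rw [e1, e2, ← ofReal_cpow (by positivity)]
      congr 1
      have : -(1 + (y + x)) = -(1 + x) + -y := by ring
      rw [this, Real.rpow_add (by positivity), 
        Real.rpow_def_of_pos (by positivity) (-y), mul_neg, ← neg_mul]
    rw [h1] at key
    rw [← key.tsum_eq, symbol, LSeries]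
    set b : ℕ → ℂ := fun n : ℕ =>
      if 2 ≤ n then ((1 / (Real.sqrt n * Real.log n) : ℝ) : ℂ) else 0 with hb
    have hterm : ∀ n : ℕ, LSeries.term b (x + 1 / 2) (n + 2) =
        ∫ y in Ioi (0 : ℝ), ((F n y : ℝ) : ℂ) := fun n => by
      have hre : ∫ y in Ioi (0 : ℝ), ((F n y : ℝ) : ℂ) = ((∫ y in Ioi (0 : ℝ), F n y : ℝ) : ℂ) :=
        integral_ofReal
      rw [hre, hval, LSeries.term_def₀ (by simp [hb])]
      have e2 : (-((x : ℂ) + 1 / 2)) = ((-(x + 1 / 2) : ℝ) : ℂ) := by push_cast; rfl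
      have e1 : (((n + 2 : ℕ)) : ℂ) = (((n : ℝ) + 2 : ℝ) : ℂ) := by push_cast; rfl
      rw [e1, e2, ← ofReal_cpow (by positivity)]
      simp only [hb, le_add_iff_nonneg_left, zero_le, if_true]
      rw [← ofReal_mul]
      congr 1
      push_cast
      have e3 : (-(1 + x)) = -(1 / 2) + -(x + 1 / 2) := by ring
      rw [e3, Real.rpow_add (by positivity), Real.rpow_neg (by positivity) (1 / 2),
        ← Real.sqrt_eq_rpow]
      field_simp
    have hsum : HasSum (LSeries.term b (x + 1 / 2)) _ :=
      (hasSum_nat_add_iff 2).1 (by simpa only [hterm] using key)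
    rw [hsum.tsum_eq, key.tsum_eq, Finset.sum_range_succ, Finset.sum_range_one,
      LSeries.term_def₀ (by simp [hb]), LSeries.term_def₀ (by simp [hb])]
    simp [hb]
  · simp only [norm_real, Real.norm_of_nonneg (hnn _ _), hval]
    refine Summable.of_nonneg_of_le (fun n => by have := hpos n; positivity) (fun n => ?_)
      ((summable_nat_add_two_rpow hx).div_const (Real.log 2))
    exact div_le_div_of_nonneg_left (by positivity) hlog2 (hlog n)

lemma HasCoeffs.isSolution {f : ℂ → ℂ} {a : ℕ → ℂ} (h : HasCoeffs f a) {lam : ℝ} (hlam : 0 < lam)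
    {c : ℂ} (heq : ∀ s ∈ halfPlane, opH f s - (lam : ℂ) * f s = c * symbol s) :
    IsSolution lam c fun y => f (y + 1 / 2) - c := by
  obtain ⟨A, hA, hf⟩ := h.norm_le_rpow
  refine ⟨hlam, h.differentiableOn_shift.sub_const c, ⟨A + ‖c‖, by positivity, fun y hy => ?_⟩,
    fun x hx => ?_⟩
  · have h1 : 0 ≤ y.re ^ (-(1 / 2) : ℝ) := by positivity
    have h2 := norm_sub_le (f (y + 1 / 2)) c
    have h3 := hf y hy
    nlinarith [mul_nonneg (norm_nonneg c) h1]
  · have hc : ContinuousOn (fun y : ℝ => f ((y : ℂ) + 1 / 2)) (Ioi 0) :=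
      h.differentiableOn_shift.continuousOn.comp (f := fun y : ℝ => (y : ℂ)) (by fun_prop)
        fun y hy => by simpa using hy
    have i1 := integrableOn_mul_kernel hc (M := A) (fun y hy => by
      have := hf y (by simpa using hy)
      rw [ofReal_re] at this
      linarith) hx
    have i2 := integrableOn_mul_kernel (Φ := fun _ => c) continuousOn_const (M := ‖c‖)
      (fun y hy => by
        have : 0 ≤ y ^ (-(1 / 2) : ℝ) := by positivity
        nlinarith [mul_nonneg (norm_nonneg c) this]) hx
    have h1 := heq (x + 1 / 2) (HasCoeffs.add_half_mem (by simpa using hx))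
    rw [opH_add_half, symbol_add_half hx] at h1
    simp only [sub_mul, sub_add_cancel]
    rw [integral_sub i1 i2, integral_const_mul]
    linear_combination -h1

/-! ### The series representation -/

/-- An entire function has bounded Taylor coefficients and is the sum of its Taylor series. -/
lemma exists_bounded_coeffs {J : ℂ → ℂ} (hJ : Differentiable ℂ J) :
    ∃ j : ℕ → ℂ, (∃ C, ∀ n, ‖j n‖ ≤ C) ∧ ∀ w, HasSum (fun n => j n * w ^ n) (J w) := by
  have h : ∀ w, HasSum (fun n : ℕ => ((n.factorial : ℂ)⁻¹ * iteratedDeriv n J 0) * w ^ n) (J w) :=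
    fun w => by
    refine (Complex.hasSum_taylorSeries_of_entire hJ 0 w).congr_fun fun n => ?_
    simp only [smul_eq_mul, sub_zero]
    ring
  refine ⟨_, ?_, h⟩
  -- Convergence at `w = 1` already forces the coefficients to tend to `0`.
  have h1 := (h 1).summable.tendsto_atTop_zero
  simp only [one_pow, mul_one] at h1
  obtain ⟨C, hC⟩ := h1.norm.bddAbove_range
  exact ⟨C, fun n => hC ⟨n, rfl⟩⟩

lemma polyBounded_of_bounded {j : ℕ → ℂ} {C : ℝ} (h : ∀ n, ‖j n‖ ≤ C) :
    PolyBounded fun k : ℕ+ => j k.natPred :=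
  ⟨C, 0, fun k => by simpa using h k.natPred⟩

lemma hasSum_repTerm {J₁ J₂ : ℂ → ℂ} {j₁ j₂ : ℕ → ℂ}
    (h1 : ∀ w, HasSum (fun n => j₁ n * w ^ n) (J₁ w))
    (h2 : ∀ w, HasSum (fun n => j₂ n * w ^ n) (J₂ w)) (θ : ℝ) {x : ℝ} (hx : 0 < x) :
    HasSum (repTerm θ x (fun k => j₁ k.natPred) fun k => j₂ k.natPred)
      (exp ((3 / 2 - I * θ) * (Real.log x : ℝ)) * J₁ (exp (2 * (Real.log x : ℝ))) +
        exp ((3 / 2 + I * θ) * (Real.log x : ℝ)) * J₂ (exp (2 * (Real.log x : ℝ)))) := by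
  rw [← Equiv.pnatEquivNat.symm.hasSum_iff]
  refine (((h1 (exp (2 * (Real.log x : ℝ)))).mul_left _).add
    ((h2 (exp (2 * (Real.log x : ℝ)))).mul_left _)).congr_fun fun n => ?_
  have hx' : (x : ℂ) ≠ 0 := by exact_mod_cast hx.ne'
  -- The index is `k = n + 1`, so `2k - 1/2 = 3/2 + 2n`.
  have e1 : ((x ^ (2 * ((n.succPNat : ℕ+) : ℝ) - 1 / 2) : ℝ) : ℂ) =
      exp (3 / 2 * (Real.log x : ℝ)) * exp (2 * (Real.log x : ℝ)) ^ n := by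
    rw [Real.rpow_def_of_pos hx, ofReal_exp, ← exp_nat_mul, ← exp_add]
    congr 1
    simp only [Nat.succPNat_coe, Nat.succ_eq_add_one]
    push_cast
    ring
  have e2 : ∀ b : ℂ, (x : ℂ) ^ b = exp (b * (Real.log x : ℝ)) := fun b => by
    rw [cpow_def_of_ne_zero hx', ← ofReal_log hx.le, mul_comm]
  simp only [Function.comp_apply, Equiv.pnatEquivNat_symm_apply, repTerm, Nat.natPred_succPNat]
  rw [e1, e2, e2, sub_mul, add_mul, sub_eq_add_neg, exp_add, exp_add, neg_mul]
  ring

/-! ### Square-integrability of the derivative -/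

/-- Differentiating the logarithm costs `x⁻¹`, which `|x^b| = x^{3/2} ≤ x` compensates on `(0, 1]`.
-/
lemma exists_bound_deriv_power {J : ℂ → ℂ} (hJ : Differentiable ℂ J) {b : ℂ} (hb : b.re = 3 / 2) :
    ∃ C, ∀ x : ℝ, 0 < x → x ≤ 1 →
      DifferentiableAt ℂ (fun y => exp (b * log y) * J (exp (2 * log y))) x ∧
      ‖deriv (fun y => exp (b * log y) * J (exp (2 * log y))) x‖ ≤ C := by
  have hdc : Continuous (deriv J) := (hJ.contDiff (n := 1)).continuous_deriv le_rfl
  obtain ⟨S₀, hS₀⟩ := (isCompact_closedBall (0 : ℂ) 1).exists_bound_of_continuousOn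
    hJ.continuous.continuousOn
  obtain ⟨S₁, hS₁⟩ := (isCompact_closedBall (0 : ℂ) 1).exists_bound_of_continuousOn
    hdc.continuousOn
  refine ⟨‖b‖ * S₀ + S₁ * 2, fun x hx hx1 => ?_⟩
  have hx' : (x : ℂ) ≠ 0 := by exact_mod_cast hx.ne'
  have hlog : HasDerivAt log (x : ℂ)⁻¹ x := hasDerivAt_log (ofReal_mem_slitPlane.2 hx)
  have hd := ((hlog.const_mul b).cexp).mul ((hJ _).hasDerivAt.comp (x : ℂ) (hlog.const_mul 2).cexp)
  have hw : ‖exp (2 * log (x : ℂ))‖ = x ^ 2 := by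
    rw [two_mul, exp_add, exp_log hx', norm_mul, Complex.norm_of_nonneg hx.le, sq]
  have hw1 : exp (2 * log (x : ℂ)) ∈ Metric.closedBall (0 : ℂ) 1 := by
    rw [mem_closedBall_zero_iff, hw]; nlinarith
  have hE : ‖exp (b * log (x : ℂ))‖ ≤ x := by
    rw [Complex.norm_exp, ← ofReal_log hx.le, re_mul_ofReal, hb]
    conv_rhs => rw [← Real.exp_log hx]
    have := Real.log_nonpos hx.le hx1
    exact Real.exp_le_exp.2 (by linarith)
  have h0 := hS₀ _ hw1
  have h1 := hS₁ _ hw1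
  have hS₀' := (norm_nonneg _).trans h0
  have hS₁' := (norm_nonneg _).trans h1
  refine ⟨hd.differentiableAt, ?_⟩
  have hD := hd.deriv
  simp only [Function.comp_def] at hD
  have hfun : (fun y => exp (b * log y) * J (exp (2 * log y))) =
      ((fun y => exp (b * log y)) * fun y => J (exp (2 * log y))) := rfl
  rw [hfun, hD]
  refine (norm_add_le _ _).trans (add_le_add ?_ ?_)
  · rw [norm_mul, norm_mul, norm_mul, norm_inv, Complex.norm_of_nonneg hx.le]
    calc _ ≤ x * (‖b‖ * x⁻¹) * S₀ := by gcongr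
      _ = _ := by field_simp
  · rw [norm_mul, norm_mul, norm_mul, norm_mul, norm_inv, Complex.norm_of_nonneg hx.le, hw]
    have h2 : ‖(2 : ℂ)‖ = 2 := by simp
    rw [h2]
    calc _ ≤ x * (S₁ * (x ^ 2 * (2 * x⁻¹))) := by gcongr
      _ = S₁ * 2 * x ^ 2 := by field_simp
      _ ≤ S₁ * 2 * 1 := by gcongr; nlinarith
      _ = _ := mul_one _

/-- Cauchy's estimate on a circle of radius `1/2`, where the real part of `z - 1/2` is at least `x -
1/2 ≥ 1/2`. This shift produces `√2` and `e^{1/8}`. -/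
lemma HasCoeffs.norm_deriv_le {f : ℂ → ℂ} {a : ℕ → ℂ} (h : HasCoeffs f a) :
    ∃ B, 0 ≤ B ∧ ∀ x : ℝ, 1 ≤ x → ‖deriv f (x + 1 / 2)‖ ≤ B * Real.exp (-(x / 4)) := by
  obtain ⟨A, hA, hf⟩ := h.norm_le
  refine ⟨2 * (A * √2 * Real.exp (1 / 8)), by positivity, fun x hx => ?_⟩
  have hre : ∀ z ∈ Metric.closedBall ((x : ℂ) + 1 / 2) (1 / 2), x - 1 / 2 ≤ (z - 1 / 2).re :=
    fun z hz => by
    have h1 : ‖z - (x + 1 / 2)‖ ≤ 1 / 2 := by simpa [dist_eq_norm] using hz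
    have h2 := (abs_le.1 ((Complex.abs_re_le_norm _).trans h1)).1
    have h3 : (z - (x + 1 / 2)).re = (z - 1 / 2).re - x := by
      rw [sub_re, sub_re, add_re, ofReal_re]; ring
    linarith
  have h1 : ‖deriv f (x + 1 / 2)‖ ≤ A * √2 * Real.exp (1 / 8) * Real.exp (-(x / 4)) / (1 / 2) := by
    refine Complex.norm_deriv_le_of_forall_mem_sphere_norm_le (by norm_num) ?_ fun z hz => ?_
    · refine DifferentiableOn.diffContOnCl fun z hz => ?_
      rw [closure_ball _ (by norm_num)] at hz
      have h2 := hre z hz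
      have h3 : z ∈ halfPlane := by
        have := HasCoeffs.add_half_mem (y := z - 1 / 2) (by linarith)
        rwa [sub_add_cancel] at this
      exact (h.differentiableOn.differentiableAt
        (HasCoeffs.isOpen_halfPlane.mem_nhds h3)).differentiableWithinAt
    · have h2 := hre z (Metric.sphere_subset_closedBall hz)
      have h3 := hf (z - 1 / 2) (by linarith)
      rw [sub_add_cancel] at h3
      refine h3.trans ?_
      rw [mul_assoc, mul_assoc]
      gcongr
      have h4 : Real.exp (1 / 8) * Real.exp (-(x / 4)) = √(Real.exp (-((x - 1 / 2) / 2))) := by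
        rw [← Real.exp_add, ← Real.exp_half]; congr 1; ring
      rw [h4, ← Real.sqrt_mul (by norm_num)]
      refine Real.sqrt_le_sqrt ?_
      gcongr
      rw [inv_le_comm₀ (by linarith) (by norm_num)]
      linarith
  exact h1.trans (le_of_eq (by ring))

theorem HasCoeffs.memLp_deriv {f : ℂ → ℂ} {a : ℕ → ℂ} (h : HasCoeffs f a) {J₁ J₂ : ℂ → ℂ}
    (hJ₁ : Differentiable ℂ J₁) (hJ₂ : Differentiable ℂ J₂) {c : ℂ} {θ : ℝ}
    (hrep : ∀ v : ℂ, |v.im| < Real.pi / 6 → f (exp v + 1 / 2) - c =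
        exp ((3 / 2 - I * θ) * v) * J₁ (exp (2 * v)) +
        exp ((3 / 2 + I * θ) * v) * J₂ (exp (2 * v))) :
    MemLp (fun s : ℝ => deriv f (s : ℂ)) 2 (volume.restrict (Ioi (1 / 2 : ℝ))) := by
  obtain ⟨C₁, hC₁⟩ := exists_bound_deriv_power hJ₁ (b := 3 / 2 - I * θ) (by simp)
  obtain ⟨C₂, hC₂⟩ := exists_bound_deriv_power hJ₂ (b := 3 / 2 + I * θ) (by simp)
  obtain ⟨B, hB0, hB⟩ := h.norm_deriv_le
  have hnear : ∀ x : ℝ, 0 < x → x ≤ 1 → ‖deriv f (x + 1 / 2)‖ ≤ C₁ + C₂ := fun x hx hx1 => by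
    obtain ⟨d1, b1⟩ := hC₁ x hx hx1
    obtain ⟨d2, b2⟩ := hC₂ x hx hx1
    have hev : (fun y => f (y + 1 / 2)) =ᶠ[𝓝 (x : ℂ)] fun y =>
        exp ((3 / 2 - I * θ) * log y) * J₁ (exp (2 * log y)) +
        exp ((3 / 2 + I * θ) * log y) * J₂ (exp (2 * log y)) + c := by
      have hxs : (x : ℂ) ∈ slitPlane := ofReal_mem_slitPlane.2 hx
      have hc : ContinuousAt (fun y => |(log y).im|) (x : ℂ) :=
        (continuous_im.continuousAt.comp (continuousAt_clog hxs)).abs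
      have h0 : |(log (x : ℂ)).im| < Real.pi / 6 := by
        rw [← ofReal_log hx.le, ofReal_im, abs_zero]; linarith [Real.pi_pos]
      filter_upwards [hc.eventually (gt_mem_nhds h0), isOpen_slitPlane.mem_nhds hxs] with y hy hys
      rw [← hrep _ hy, exp_log (slitPlane_ne_zero hys), sub_add_cancel]
    have hderiv : deriv f (x + 1 / 2) = deriv (fun y => f (y + 1 / 2)) (x : ℂ) :=
      (deriv_comp_add_const f (1 / 2) (x : ℂ)).symm
    rw [hderiv, hev.deriv_eq, deriv_add_const, deriv_fun_add d1 d2]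
    exact (norm_add_le _ _).trans (add_le_add b1 b2)
  have hcont : ContinuousOn (fun s : ℝ => deriv f (s : ℂ)) (Ioi (1 / 2)) :=
    (h.differentiableOn.deriv HasCoeffs.isOpen_halfPlane).continuousOn.comp
      (f := fun s : ℝ => (s : ℂ)) (by fun_prop) fun s hs => by
        simpa [halfPlane] using hs
  have hmeas := hcont.aestronglyMeasurable (μ := volume) measurableSet_Ioi
  rw [memLp_two_iff_integrable_sq_norm hmeas]
  have hC0 : 0 ≤ C₁ + C₂ := (norm_nonneg _).trans (hnear 1 one_pos le_rfl)
  -- One exponential majorant for both ranges: `e^{3/8 - s/4} ≥ 1` for `s ≤ 3/2`, and `e^{1/8}`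
  -- undoes the shift `x = s - 1/2`.
  set D := (C₁ + C₂) * Real.exp (3 / 8) + B * Real.exp (1 / 8) with hD
  have hexp := (integrableOn_exp_mul_Ioi (a := -(1 / 2)) (by norm_num) (1 / 2)).const_mul (D ^ 2)
  refine Integrable.mono' hexp (hmeas.norm.pow 2) ?_
  filter_upwards [ae_restrict_mem measurableSet_Ioi] with s hs
  have hs' : (1 / 2 : ℝ) < s := hs
  have hbound : ‖deriv f (s : ℂ)‖ ≤ D * Real.exp (-(s / 4)) := by
    have e : (s : ℂ) = ((s - 1 / 2 : ℝ) : ℂ) + 1 / 2 := by push_cast; ring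
    rw [hD, add_mul, mul_assoc, mul_assoc, ← Real.exp_add, ← Real.exp_add]
    rcases le_total (s - 1 / 2) 1 with h1 | h1
    · have h2 := hnear (s - 1 / 2) (by linarith) h1
      rw [← e] at h2
      have h3 : 1 ≤ Real.exp (3 / 8 + -(s / 4)) := Real.one_le_exp (by linarith)
      have h4 : 0 ≤ B * Real.exp (1 / 8 + -(s / 4)) := by positivity
      nlinarith
    · have h2 := hB (s - 1 / 2) h1
      rw [← e, show -((s - 1 / 2) / 4) = 1 / 8 + -(s / 4) by ring] at h2
      have h4 : 0 ≤ (C₁ + C₂) * Real.exp (3 / 8 + -(s / 4)) := by positivity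
      linarith
  rw [Real.norm_of_nonneg (by positivity)]
  calc ‖deriv f (s : ℂ)‖ ^ 2 ≤ (D * Real.exp (-(s / 4))) ^ 2 := by gcongr
    _ = D ^ 2 * Real.exp (-(1 / 2) * s) := by
      rw [mul_pow, ← Real.exp_nat_mul]; congr 2; push_cast; ring

end MultHilbert

/-! ### Assembly of the theorem -/

theorem theorem3 (lam : ℝ) (hlam0 : 0 < lam) (hlampi : lam < Real.pi) (c : ℂ) (f : ℂ → ℂ)
    (hf : MultHilbert.MemH20 f)
    (heq : ∀ s ∈ MultHilbert.halfPlane,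
      MultHilbert.opH f s - (lam : ℂ) * f s = c * MultHilbert.symbol s) :
    (∃ (d : ℂ) (ck dk : ℕ+ → ℂ),
      MultHilbert.PolyBounded ck ∧ MultHilbert.PolyBounded dk ∧
      ∀ s : ℝ, 1 / 2 < s → s < 3 / 2 →
        Summable (MultHilbert.repTerm (MultHilbert.theta lam) (s - 1 / 2) ck dk) ∧
        f (s : ℂ) = c * d +
          ∑' k : ℕ+, MultHilbert.repTerm (MultHilbert.theta lam) (s - 1 / 2) ck dk k) ∧
    DifferentiableOn ℂ f MultHilbert.halfPlane ∧
    MemLp (fun s : ℝ => deriv f (s : ℂ)) 2 (volume.restrict (Ioi (1 / 2 : ℝ))) := by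
  obtain ⟨a, ha⟩ := hf.exists_hasCoeffs
  have hsol := ha.isSolution hlam0 heq
  have hsmall : Tendsto (fun x : ℝ => (√x : ℂ) * (f (x + 1 / 2) - c)) (𝓝[>] 0) (𝓝 0) := by
    have h1 : Tendsto (fun x : ℝ => (√x : ℂ) * c) (𝓝[>] 0) (𝓝 0) := by
      have : Continuous fun x : ℝ => (√x : ℂ) * c := by fun_prop
      simpa using (this.tendsto 0).mono_left nhdsWithin_le_nhds
    simpa only [mul_sub, sub_zero] using ha.tendsto_sqrt_mul.sub h1
  obtain ⟨J₁, J₂, hJ₁, hJ₂, hrep⟩ := hsol.exists_decomposition hlampi hsmall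
  refine ⟨?_, ha.differentiableOn, ha.memLp_deriv hJ₁ hJ₂ hrep⟩
  obtain ⟨j₁, ⟨C₁, hC₁⟩, hs₁⟩ := MultHilbert.exists_bounded_coeffs hJ₁
  obtain ⟨j₂, ⟨C₂, hC₂⟩, hs₂⟩ := MultHilbert.exists_bounded_coeffs hJ₂
  -- Here `d = 1`, because the function being expanded is `f - c`.
  refine ⟨1, _, _, MultHilbert.polyBounded_of_bounded hC₁, MultHilbert.polyBounded_of_bounded hC₂,
    fun s hs _ => ?_⟩
  have hx : 0 < s - 1 / 2 := by linarith
  have hsum := MultHilbert.hasSum_repTerm hs₁ hs₂ (MultHilbert.theta lam) hx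
  refine ⟨hsum.summable, ?_⟩
  have h1 := hrep (Real.log (s - 1 / 2) : ℝ) (by simp [Real.pi_pos])
  rw [← ofReal_exp, Real.exp_log hx] at h1
  rw [hsum.tsum_eq, ← h1]
  push_cast
  rw [sub_add_cancel]
  ring
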